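/- Notation. For $p>1$ let $\mathrm{Sym}^+(p)$ be the set of symmetric positive-definite real $p\times p$ matrices, $\mathrm{Diag}^+(p)$ the set of diagonal matrices with positive diagonal entries, $M(p)=SO(p)\times \mathrm{Diag}^+(p)$, and $F:M(p)\to\mathrm{Sym}^+(p)$, $F(U,D)=UDU^T$, with fibers $\mathcal E_X=F^{-1}(X)$. Let $g_{SO}$ be the bi-invariant Riemannian metric on $SO(p)$ with $g_{SO}|_I(A_1,A_2)=-\frac12\mathrm{tr}(A_1A_2)$, let $g_{\mathcal D^+}|_D(L_1,L_2)=\mathrm{tr}(D^{-1}L_1D^{-1}L_2)$ on $\mathrm{Diag}^+(p)$, and, for a fixed parameter $k>0$, let $g_M=k\,g_{SO}\oplus g_{\mathcal D^+}$ on $M(p)$, with geodesic distance $d_M$ (the infimum of the lengths of piecewise smooth curves). The top stratum of $M(p)$ consists of the pairs $(U,D)$ such that the diagonal entries of $D$ are pairwise distinct; the top stratum of $\mathrm{Sym}^+(p)$ consists of the matrices with $p$ distinct eigenvalues. For $X,Y\in\mathrm{Sym}^+(p)$ let $d_{\mathcal{SR}}(X,Y)=\inf\{d_M(P,Q): P\in\mathcal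 E_X,\ Q\in\mathcal E_Y\}$. An $F$-minimal geodesic from $\mathcal E_X$ to $\mathcal E_Y$ is a piecewise smooth curve $\gamma:[0,1]\to M(p)$, parametrized proportionally to arc length, with $\gamma(0)\in\mathcal E_X$, $\gamma(1)\in\mathcal E_Y$ and length $d_{\mathcal{SR}}(X,Y)$. Its pair of endpoints $(\gamma(0),\gamma(1))$ is called a minimal pair, and $F\circ\gamma$ is called a minimal smooth scaling-rotation (MSSR) curve from $X$ to $Y$, corresponding to that minimal pair. $\mathcal M(X,Y)$ is the set of all MSSR curves from $X$ to $Y$. It exhibits Type II non-uniqueness if there are two $F$-minimal geodesics $\gamma_1,\gamma_2$ from $\mathcal E_X$ to $\mathcal E_Y$ with the same endpoints, $\gamma_1(0)=\gamma_2(0)$ and $\gamma_1(1)=\gamma_2(1)$, such that $F\circ\gamma_1$ and $F\circ\gamma_2$ are different curves (neither is a monotone reparametrization of the other). A pair $((U,D),(V,\Lambda))\in M(p)\times M(p)$ is geodesically antipodal if one of $U,V$ lies in the cut-locus of the other in $(SO(p),g_{SO})$. Corollary. Let $p\ge 11$ and $k>0$. There exist geodesically antipodal, minimal pairs $((U,D),(V,\Lambda))$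 such that both $(U,D)$ and $(V,\Lambda)$ lie in the top stratum of $M(p)$. Hence there exist $X,Y$ in the top stratum of $\mathrm{Sym}^+(p)$ (that is, each having $p$ distinct eigenvalues) for which $\mathcal M(X,Y)$ exhibits Type II non-uniqueness. -/

import Mathlib

open scoped ContDiff

namespace ScalingRotation

/-- The special orthogonal group `SO(p)`, as a set of real `p × p` matrices. -/
abbrev SO (p : ℕ) : Type := Matrix.specialOrthogonalGroup (Fin p) ℝ

/-- `Diag⁺(p)`: diagonal matrices with positive diagonal entries, identified with their diagonals. -/
abbrev DiagPos (p : ℕ) : Type := {d : Fin p → ℝ // ∀ i, 0 < d i}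

/-- `Sym⁺(p)`: symmetric positive-definite real `p × p` matrices. -/
abbrev SymPos (p : ℕ) : Type := {X : Matrix (Fin p) (Fin p) ℝ // X.PosDef}

/-- The space of eigen-decompositions `M(p) = SO(p) × Diag⁺(p)`. -/
abbrev M (p : ℕ) : Type := SO p × DiagPos p

theorem eigenComp_posDef {p : ℕ} (P : M p) :
    ((P.1 : Matrix (Fin p) (Fin p) ℝ) * Matrix.diagonal P.2.1 *
      (P.1 : Matrix (Fin p) (Fin p) ℝ).transpose).PosDef := by
  have hd : (Matrix.diagonal P.2.1).PosDef := Matrix.PosDef.diagonal P.2.2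
  have hU := (Matrix.mem_specialOrthogonalGroup_iff.1 P.1.2).1
  have h1 : (P.1 : Matrix (Fin p) (Fin p) ℝ) * star (P.1 : Matrix (Fin p) (Fin p) ℝ) = 1 :=
    Matrix.mem_unitaryGroup_iff.1 hU
  have h := hd.mul_mul_conjTranspose_same (B := (P.1 : Matrix (Fin p) (Fin p) ℝ))
    (Matrix.vecMul_injective_of_isUnit (IsUnit.of_mul_eq_one _ h1))
  rwa [Matrix.conjTranspose_eq_transpose_of_trivial] at h

/-- The eigen-composition map `F : M(p) → Sym⁺(p)`, `F(U, D) = U D Uᵀ`. -/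
def F {p : ℕ} (P : M p) : SymPos p :=
  ⟨(P.1 : Matrix (Fin p) (Fin p) ℝ) * Matrix.diagonal P.2.1 *
    (P.1 : Matrix (Fin p) (Fin p) ℝ).transpose, eigenComp_posDef P⟩

/-- The fiber `E_X = F⁻¹(X)`. -/
def fiber {p : ℕ} (X : SymPos p) : Set (M p) := {P | F P = X}

/-- The top stratum of `M(p)`: the pairs `(U, D)` such that `D` has distinct diagonal entries. -/
def topStratumM (p : ℕ) : Set (M p) := {P | Function.Injective P.2.1}

/-- The top stratum of `Sym⁺(p)`: the matrices with `p` distinct eigenvalues. -/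
def topStratumSym (p : ℕ) : Set (SymPos p) :=
  {X | Function.Injective X.2.isHermitian.eigenvalues}

/-- A family of real functions is piecewise smooth on `[a, b]`: there is a common finite subdivision
of `[a, b]` such that every function is `C^∞` on each closed subinterval (in particular continuous
on `[a, b]`). -/
def IsPiecewiseSmooth {ι : Type} (a b : ℝ) (f : ι → ℝ → ℝ) : Prop :=
  ∃ (n : ℕ) (τ : ℕ → ℝ), Monotone τ ∧ τ 0 = a ∧ τ n = b ∧
    ∀ m < n, ∀ i, ContDiffOn ℝ ∞ (f i) (Set.Icc (τ m) (τ (m + 1)))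

/-! Riemannian geometry of `SO(p)` -/

/-- The bi-invariant Riemannian metric of `SO(p)` whose value at the identity is
`-(1/2) tr (A₁ A₂)`; a tangent vector `T` at `U` is carried to the identity as `U⁻¹ T = Uᵀ T`. -/
noncomputable def gSO {p : ℕ} (U : SO p) (T₁ T₂ : Matrix (Fin p) (Fin p) ℝ) : ℝ :=
  -(1 / 2) * Matrix.trace
    (((U : Matrix (Fin p) (Fin p) ℝ).transpose * T₁) *
      ((U : Matrix (Fin p) (Fin p) ℝ).transpose * T₂))

/-- The velocity of a curve in `SO(p)`. -/
noncomputable def velSO {p : ℕ} (c : ℝ → SO p) (t : ℝ) : Matrix (Fin p) (Fin p) ℝ :=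
  Matrix.of fun i j => deriv (fun s => (c s : Matrix (Fin p) (Fin p) ℝ) i j) t

/-- The length of the restriction to `[a, b]` of a curve in `SO(p)`. -/
noncomputable def lengthSO {p : ℕ} (c : ℝ → SO p) (a b : ℝ) : ℝ :=
  ∫ t in a..b, Real.sqrt (gSO (c t) (velSO c t) (velSO c t))

/-- Piecewise smooth curves `[a, b] → SO(p)`; values outside `[a, b]` are irrelevant. -/
def IsPiecewiseSmoothSO {p : ℕ} (a b : ℝ) (c : ℝ → SO p) : Prop :=
  IsPiecewiseSmooth a b
    fun (ij : Fin p × Fin p) t => (c t : Matrix (Fin p) (Fin p) ℝ) ij.1 ij.2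

/-- The geodesic distance of `SO(p)`: the infimum of the lengths of piecewise smooth curves. -/
noncomputable def distSO {p : ℕ} (U V : SO p) : ℝ :=
  sInf {r | ∃ c : ℝ → SO p, IsPiecewiseSmoothSO 0 1 c ∧ c 0 = U ∧ c 1 = V ∧ r = lengthSO c 0 1}

/-- Complete unit-speed geodesics of `SO(p)`: curves that locally realize the geodesic distance and
are parametrized by arc length. -/
def IsUnitSpeedGeodesicSO {p : ℕ} (c : ℝ → SO p) : Prop :=
  ∀ t₀ : ℝ, ∃ ε > 0, ∀ t₁ t₂ : ℝ, |t₁ - t₀| < ε → |t₂ - t₀| < ε →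
    distSO (c t₁) (c t₂) = |t₁ - t₂|

/-- The cut-locus of `U` in `SO(p)`: the points at which a geodesic that starts at `U` ceases to be
length-minimizing. -/
def cutLocusSO {p : ℕ} (U : SO p) : Set (SO p) :=
  {V | ∃ c : ℝ → SO p, IsUnitSpeedGeodesicSO c ∧ c 0 = U ∧
    ∃ t₀ > 0, c t₀ = V ∧ distSO (c 0) (c t₀) = t₀ ∧ ∀ t > t₀, distSO (c 0) (c t) < t}

/-- Geodesically antipodal pairs in `SO(p) × SO(p)`. -/
def IsGeodesicallyAntipodalSO {p : ℕ} (U V : SO p) : Prop :=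
  V ∈ cutLocusSO U ∨ U ∈ cutLocusSO V

/-- Geodesically antipodal pairs in `M(p) × M(p)`. -/
def IsGeodesicallyAntipodal {p : ℕ} (P Q : M p) : Prop :=
  IsGeodesicallyAntipodalSO P.1 Q.1

/-! Riemannian geometry of `M(p)` -/

/-- The invariant Riemannian metric `tr (D⁻¹ L₁ D⁻¹ L₂)` of `Diag⁺(p)`. -/
noncomputable def gDiag {p : ℕ} (D : DiagPos p) (L₁ L₂ : Fin p → ℝ) : ℝ :=
  ∑ i, (D.1 i)⁻¹ * L₁ i * ((D.1 i)⁻¹ * L₂ i)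

/-- The speed of a curve in `M(p)` for the product metric `g_M = k g_SO ⊕ g_Diag`. -/
noncomputable def speed {p : ℕ} (k : ℝ) (γ : ℝ → M p) (t : ℝ) : ℝ :=
  Real.sqrt
    (k * gSO (γ t).1 (velSO (fun s => (γ s).1) t) (velSO (fun s => (γ s).1) t) +
      gDiag (γ t).2 (fun i => deriv (fun s => (γ s).2.1 i) t)
        (fun i => deriv (fun s => (γ s).2.1 i) t))

/-- The length of the restriction to `[a, b]` of a curve in `M(p)`. -/
noncomputable def length {p : ℕ} (k : ℝ) (γ : ℝ → M p) (a b : ℝ) : ℝ :=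
  ∫ t in a..b, speed k γ t

/-- Piecewise smooth curves `[a, b] → M(p)`; values outside `[a, b]` are irrelevant. -/
def IsPiecewiseSmoothM {p : ℕ} (a b : ℝ) (γ : ℝ → M p) : Prop :=
  IsPiecewiseSmooth a b
    (Sum.elim
      (fun (ij : Fin p × Fin p) t => ((γ t).1 : Matrix (Fin p) (Fin p) ℝ) ij.1 ij.2)
      (fun (i : Fin p) t => (γ t).2.1 i))

/-- The geodesic distance `d_M` of `(M(p), g_M)`. -/
noncomputable def distM {p : ℕ} (k : ℝ) (P Q : M p) : ℝ :=
  sInf {r | ∃ γ : ℝ → M p, IsPiecewiseSmoothM 0 1 γ ∧ γ 0 = P ∧ γ 1 = Q ∧ r = length k γ 0 1}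

/-! Scaling-rotation distance and minimal smooth scaling-rotation curves -/

/-- The scaling-rotation distance: the infimum of `d_M` over `E_X × E_Y`. -/
noncomputable def dSR {p : ℕ} (k : ℝ) (X Y : SymPos p) : ℝ :=
  sInf {r | ∃ P ∈ fiber X, ∃ Q ∈ fiber Y, r = distM k P Q}

/-- `γ : [0,1] → M(p)` is an `F`-minimal geodesic from `E_X` to `E_Y`: a piecewise smooth curve from
`E_X` to `E_Y` whose length is `d_SR(X, Y)`, parametrized proportionally to arc length. -/
structure IsFMinimalGeodesic {p : ℕ} (k : ℝ) (X Y : SymPos p) (γ : ℝ → M p) : Prop where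
  piecewiseSmooth : IsPiecewiseSmoothM 0 1 γ
  start_mem : γ 0 ∈ fiber X
  end_mem : γ 1 ∈ fiber Y
  length_eq : length k γ 0 1 = dSR k X Y
  proportional : ∀ t ∈ Set.Icc (0 : ℝ) 1, length k γ 0 t = t * length k γ 0 1

/-- `(P, Q)` is a minimal pair: `P` and `Q` are the endpoints of an `F`-minimal geodesic from
`E_X` to `E_Y`, where `X = F(P)` and `Y = F(Q)`. -/
def IsMinimalPair {p : ℕ} (k : ℝ) (P Q : M p) : Prop :=
  ∃ γ : ℝ → M p, IsFMinimalGeodesic k (F P) (F Q) γ ∧ γ 0 = P ∧ γ 1 = Q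

/-- The projection `F ∘ γ : [0,1] → Sym⁺(p)` of a curve `γ : [0,1] → M(p)`. -/
def proj {p : ℕ} (γ : ℝ → M p) : unitInterval → SymPos p := fun t => F (γ t)

/-- `𝓜(X, Y)`: the minimal smooth scaling-rotation (MSSR) curves from `X` to `Y`. -/
def mssrCurves {p : ℕ} (k : ℝ) (X Y : SymPos p) : Set (unitInterval → SymPos p) :=
  {χ | ∃ γ : ℝ → M p, IsFMinimalGeodesic k X Y γ ∧ χ = proj γ}

/-- The MSSR curve `χ` from `X` to `Y` corresponds to the (minimal) pair `(P, Q)`. -/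
def CorrespondsTo {p : ℕ} (k : ℝ) (X Y : SymPos p) (χ : unitInterval → SymPos p) (P Q : M p) :
    Prop :=
  ∃ γ : ℝ → M p, IsFMinimalGeodesic k X Y γ ∧ γ 0 = P ∧ γ 1 = Q ∧ χ = proj γ

/-- `χ₁` is a monotone reparametrization of `χ₂` (for instance, equal to it). -/
def IsReparametrization {p : ℕ} (χ₁ χ₂ : unitInterval → SymPos p) : Prop :=
  ∃ φ : unitInterval → unitInterval, Continuous φ ∧ Monotone φ ∧ Function.Surjective φ ∧
    χ₁ = χ₂ ∘ φ

/-- Type II non-uniqueness: two MSSR curves from `X` to `Y` that differ, even up to monotone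
reparametrization, correspond to the same minimal pair. -/
def TypeIINonuniqueness {p : ℕ} (k : ℝ) (X Y : SymPos p) : Prop :=
  ∃ χ₁ ∈ mssrCurves k X Y, ∃ χ₂ ∈ mssrCurves k X Y,
    ¬ IsReparametrization χ₁ χ₂ ∧ ¬ IsReparametrization χ₂ χ₁ ∧
    ∃ P Q : M p, CorrespondsTo k X Y χ₁ P Q ∧ CorrespondsTo k X Y χ₂ P Q

end ScalingRotation

namespace ScalingRotation

open Matrix MeasureTheory

/-! Let `R` be the half turn of a plane with orthonormal basis `u, v`, and let `D` be a diagonal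
matrix whose log entries are pairwise at least `√k π` apart. Turning through `π` or through `-π`
leads from `(1, D)` to `(R, D)` along two curves of length `√k π`. Everything rests on showing that
no curve between the two fibers is shorter. Then both rotations are `F`-minimal, `R` is a cut point
of `1`, and the two projections differ because the plane is oblique to the coordinate axes.

A competing curve either ends with a different diagonal part or does not. In the first case some
diagonal entry moves from one entry of `D` to another, and the log gap already costs `√k π`
(`abs_log_sub_log_le_length`). In the second case the rotational part goes from `G` to `R S G`, with
`S` a diagonal matrix of signs of determinant `1` (`sqrt_mul_pi_le_length`), and the rotation `R S`
must be shown to be at distance at least `π` from `1`.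

If `S` is the identity or has at least three entries `-1`, then `R S` reverses some vector, which
therefore turns through the angle `π`. If `S` has exactly two entries `-1`, at `a` and `b`, let `N`
be the orthogonal projection onto the span of `e_a, e_b, u, v`. The curve moves the unit Frobenius
vector `N / 2` along a sphere at most `1/√2` times as fast as it moves in `SO(p)`
(`angle_le_length`), and the inner product of the end positions is `-1 + (u_a² + v_a²) + (u_b² +
v_b²)`. A plane whose vectors are spread over many coordinates makes this at most `-34/55`, and `√2
arccos (-34/55) ≥ π`. The condition `p ≥ 11` leaves room for such a plane. -/

/-! ### Frobenius norm and the metric of `SO(p)` -/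

/-- The squared Frobenius norm. -/
def frobSq {m n : Type*} [Fintype m] [Fintype n] (A : Matrix m n ℝ) : ℝ := (Aᵀ * A).trace

theorem frobSq_eq_sum {m n : Type*} [Fintype m] [Fintype n] (A : Matrix m n ℝ) :
    frobSq A = ∑ j, ∑ i, A i j ^ 2 := by
  simp [frobSq, Matrix.trace, Matrix.mul_apply, sq]

theorem frobSq_nonneg {m n : Type*} [Fintype m] [Fintype n] (A : Matrix m n ℝ) :
    0 ≤ frobSq A := by
  rw [frobSq_eq_sum]; positivity

theorem trace_transpose_mul_eq_sum {m n : Type*} [Fintype m] [Fintype n] (A B : Matrix m n ℝ) :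
    (Aᵀ * B).trace = ∑ j, ∑ i, A i j * B i j := by
  simp [Matrix.trace, Matrix.mul_apply]

theorem trace_transpose_mul_sq_le {m n : Type*} [Fintype m] [Fintype n] (A B : Matrix m n ℝ) :
    (Aᵀ * B).trace ^ 2 ≤ frobSq A * frobSq B := by
  rw [trace_transpose_mul_eq_sum, frobSq_eq_sum, frobSq_eq_sum]
  simp only [← Finset.sum_product']
  exact Finset.sum_mul_sq_le_sq_mul_sq _ _ _

theorem SO_transpose_mul {p : ℕ} (U : SO p) : (U.1)ᵀ * U.1 = 1 := by
  have h := (Matrix.mem_specialOrthogonalGroup_iff.1 U.2).1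
  simpa [Matrix.star_eq_conjTranspose] using Matrix.mem_unitaryGroup_iff'.1 h

theorem SO_mul_transpose {p : ℕ} (U : SO p) : U.1 * (U.1)ᵀ = 1 :=
  mul_eq_one_comm.1 (SO_transpose_mul U)

theorem frobSq_orthogonal_mul {m n : Type*} [Fintype m] [Fintype n] [DecidableEq m]
    {Q : Matrix m m ℝ} (hQ : Qᵀ * Q = 1) (A : Matrix m n ℝ) : frobSq (Q * A) = frobSq A := by
  rw [frobSq, frobSq, Matrix.transpose_mul, Matrix.mul_assoc, ← Matrix.mul_assoc Qᵀ, hQ,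
    Matrix.one_mul]

theorem hasDerivAt_velSO {p : ℕ} {c : ℝ → SO p} {t : ℝ}
    (hc : ∀ i j, DifferentiableAt ℝ (fun s => (c s).1 i j) t) (i j : Fin p) :
    HasDerivAt (fun s => (c s).1 i j) (velSO c t i j) t := (hc i j).hasDerivAt

theorem velSO_skew {p : ℕ} {c : ℝ → SO p} {t : ℝ}
    (hc : ∀ i j, DifferentiableAt ℝ (fun s => (c s).1 i j) t) :
    ((c t).1ᵀ * velSO c t)ᵀ = -((c t).1ᵀ * velSO c t) := by
  ext i j
  have h1 : HasDerivAt (fun s => ((c s).1ᵀ * (c s).1) i j)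
      (∑ l, (velSO c t l i * (c t).1 l j + (c t).1 l i * velSO c t l j)) t := by
    simp only [Matrix.mul_apply, Matrix.transpose_apply]
    exact HasDerivAt.fun_sum fun l _ =>
      (hasDerivAt_velSO hc l i).mul (hasDerivAt_velSO hc l j)
  have h2 : (fun s => ((c s).1ᵀ * (c s).1) i j) = fun _ => (1 : Matrix (Fin p) (Fin p) ℝ) i j := by
    funext s; rw [SO_transpose_mul]
  rw [h2] at h1
  have h3 := h1.unique (hasDerivAt_const _ _)
  rw [Finset.sum_add_distrib] at h3
  simp only [Matrix.transpose_apply, Matrix.neg_apply, Matrix.mul_apply]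
  have h4 : ∑ l, velSO c t l i * (c t).1 l j = ∑ l, (c t).1 l j * velSO c t l i :=
    Finset.sum_congr rfl fun _ _ => mul_comm _ _
  linarith

/-- For skew `A` one has `-tr (A A) = |A|²`, and carrying the velocity back to the identity
preserves the Frobenius norm. -/
theorem gSO_velSO {p : ℕ} {c : ℝ → SO p} {t : ℝ}
    (hc : ∀ i j, DifferentiableAt ℝ (fun s => (c s).1 i j) t) :
    gSO (c t) (velSO c t) (velSO c t) = 1 / 2 * frobSq (velSO c t) := by
  have h := velSO_skew hc
  have h5 : frobSq ((c t).1ᵀ * velSO c t) = frobSq (velSO c t) :=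
    frobSq_orthogonal_mul (by simpa using SO_mul_transpose (c t)) _
  rw [← h5, frobSq, h, gSO]
  simp

theorem gDiag_self_nonneg {p : ℕ} (D : DiagPos p) (L : Fin p → ℝ) : 0 ≤ gDiag D L L :=
  Finset.sum_nonneg fun _ _ => mul_self_nonneg _

/-! ### Lower bounds for the length of a curve -/

/-- The speed of a curve that is smooth on a closed interval is integrable there. -/
theorem intervalIntegrable_speed_of_contDiffOn {p : ℕ} (k : ℝ) {γ : ℝ → M p} {a b : ℝ} (hab : a < b)
    (h1 : ∀ i j, ContDiffOn ℝ ∞ (fun t => (γ t).1.1 i j) (Set.Icc a b))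
    (h2 : ∀ i, ContDiffOn ℝ ∞ (fun t => (γ t).2.1 i) (Set.Icc a b)) :
    IntervalIntegrable (speed k γ) volume a b := by
  have hu := uniqueDiffOn_Icc hab
  have k1 : ∀ i j, ContinuousOn (fun t => derivWithin (fun t => (γ t).1.1 i j) (Set.Icc a b) t)
      (Set.Icc a b) := fun i j => (h1 i j).continuousOn_derivWithin hu (by simp)
  have k2 : ∀ i, ContinuousOn (fun t => derivWithin (fun t => (γ t).2.1 i) (Set.Icc a b) t)
      (Set.Icc a b) := fun i => (h2 i).continuousOn_derivWithin hu (by simp)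
  have k3 : ∀ i, ContinuousOn (fun t => ((γ t).2.1 i)⁻¹) (Set.Icc a b) := fun i =>
    (h2 i).continuousOn.inv₀ fun t _ => ((γ t).2.2 i).ne'
  let W : ℝ → Matrix (Fin p) (Fin p) ℝ := fun t =>
    Matrix.of fun i j => derivWithin (fun t => (γ t).1.1 i j) (Set.Icc a b) t
  let V : ℝ → Fin p → ℝ := fun t i => derivWithin (fun t => (γ t).2.1 i) (Set.Icc a b) t
  let S : ℝ → ℝ := fun t => Real.sqrt (k * gSO (γ t).1 (W t) (W t) + gDiag (γ t).2 (V t) (V t))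
  have hS : ContinuousOn S (Set.Icc a b) := by
    refine Real.continuous_sqrt.comp_continuousOn (ContinuousOn.add (continuousOn_const.mul ?_) ?_)
    · simp only [gSO, Matrix.trace, Matrix.diag, Matrix.mul_apply, Matrix.transpose_apply]
      refine continuousOn_const.mul (continuousOn_finsetSum _ fun i _ =>
        continuousOn_finsetSum _ fun j _ => ContinuousOn.mul ?_ ?_) <;>
      exact continuousOn_finsetSum _ fun l _ => (h1 _ _).continuousOn.mul (k1 _ _)
    · exact continuousOn_finsetSum _ fun i _ => ((k3 i).mul (k2 i)).mul ((k3 i).mul (k2 i))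
  have hi : IntervalIntegrable S volume a b :=
    ContinuousOn.intervalIntegrable (by rwa [Set.uIcc_of_le hab.le])
  refine hi.congr_ae ?_
  -- `speed` uses two-sided derivatives, which are known to agree with the one-sided ones only in
  -- the interior; the endpoints are a null set.
  rw [Set.uIoc_of_le hab.le, ← restrict_Ioo_eq_restrict_Ioc]
  refine (ae_restrict_mem measurableSet_Ioo).mono fun t ht => ?_
  have hn : Set.Icc a b ∈ nhds t := Icc_mem_nhds ht.1 ht.2
  simp only [S, speed, W, V, velSO, derivWithin_of_mem_nhds hn]

theorem sub_le_integral_of_subdivision {n : ℕ} {τ : ℕ → ℝ} (hτ : Monotone τ) {Ψ φ : ℝ → ℝ}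
    (h : ∀ m < n, τ m < τ (m + 1) → IntervalIntegrable φ volume (τ m) (τ (m + 1)) ∧
      Ψ (τ (m + 1)) - Ψ (τ m) ≤ ∫ t in τ m..τ (m + 1), φ t) :
    IntervalIntegrable φ volume (τ 0) (τ n) ∧ Ψ (τ n) - Ψ (τ 0) ≤ ∫ t in τ 0..τ n, φ t := by
  induction n with
  | zero => simp
  | succ n ih =>
    obtain ⟨i1, i2⟩ := ih fun m hm => h m (by omega)
    have h3 : IntervalIntegrable φ volume (τ n) (τ (n + 1)) ∧
        Ψ (τ (n + 1)) - Ψ (τ n) ≤ ∫ t in τ n..τ (n + 1), φ t := by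
      rcases (hτ (Nat.le_succ n)).lt_or_eq with h' | h'
      · exact h n (by omega) h'
      · simp only [Nat.succ_eq_add_one] at h'
        simp [h']
    refine ⟨i1.trans h3.1, ?_⟩
    rw [← intervalIntegral.integral_add_adjacent_intervals i1 h3.1]
    linarith [h3.2]

/-- A function along a curve whose derivative is at most the speed grows at most by the length. -/
theorem sub_le_length {p : ℕ} {k : ℝ} {γ : ℝ → M p} (hγ : IsPiecewiseSmoothM 0 1 γ) {Ψ : ℝ → ℝ}
    (hc : ∀ s : Set ℝ, (∀ i j, ContinuousOn (fun t => (γ t).1.1 i j) s) →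
      (∀ i, ContinuousOn (fun t => (γ t).2.1 i) s) → ContinuousOn Ψ s)
    (hd : ∀ t, (∀ i j, DifferentiableAt ℝ (fun s => (γ s).1.1 i j) t) →
      (∀ i, DifferentiableAt ℝ (fun s => (γ s).2.1 i) t) →
      ∃ d, HasDerivAt Ψ d t ∧ d ≤ speed k γ t) :
    Ψ 1 - Ψ 0 ≤ length k γ 0 1 := by
  obtain ⟨n, τ, hτ, h0, h1, hs⟩ := hγ
  rw [← h0, ← h1]
  refine (sub_le_integral_of_subdivision hτ fun m hm hlt => ?_).2
  have s1 : ∀ i j, ContDiffOn ℝ ∞ (fun t => (γ t).1.1 i j) (Set.Icc (τ m) (τ (m + 1))) :=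
    fun i j => hs m hm (Sum.inl (i, j))
  have s2 : ∀ i, ContDiffOn ℝ ∞ (fun t => (γ t).2.1 i) (Set.Icc (τ m) (τ (m + 1))) :=
    fun i => hs m hm (Sum.inr i)
  have hint := intervalIntegrable_speed_of_contDiffOn k hlt s1 s2
  refine ⟨hint, ?_⟩
  have hd' : ∀ t ∈ Set.Ioo (τ m) (τ (m + 1)), ∃ d, HasDerivAt Ψ d t ∧ d ≤ speed k γ t :=
    fun t ht => by
      have hn : Set.Icc (τ m) (τ (m + 1)) ∈ nhds t := Icc_mem_nhds ht.1 ht.2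
      exact hd t (fun i j => ((s1 i j).contDiffAt hn).differentiableAt (by simp))
        (fun i => ((s2 i).contDiffAt hn).differentiableAt (by simp))
  choose! d hd1 hd2 using hd'
  exact intervalIntegral.sub_le_integral_of_hasDeriv_right_of_le hlt.le
    (hc _ (fun i j => (s1 i j).continuousOn) (fun i => (s2 i).continuousOn))
    (fun t ht => (hd1 t ht).hasDerivWithinAt)
    ((intervalIntegrable_iff_integrableOn_Icc_of_le hlt.le).1 hint) hd2

/-- In logarithmic coordinates the metric of `Diag⁺(p)` is Euclidean, so the speed dominates the
rate of change of each coordinate. -/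
theorem abs_log_sub_log_le_length {p : ℕ} {k : ℝ} (hk : 0 ≤ k) {γ : ℝ → M p}
    (hγ : IsPiecewiseSmoothM 0 1 γ) (i : Fin p) :
    |Real.log ((γ 1).2.1 i) - Real.log ((γ 0).2.1 i)| ≤ length k γ 0 1 := by
  have key : ∀ e : ℝ, |e| = 1 →
      e * Real.log ((γ 1).2.1 i) - e * Real.log ((γ 0).2.1 i) ≤ length k γ 0 1 := by
    intro e he
    refine sub_le_length hγ (Ψ := fun t => e * Real.log ((γ t).2.1 i)) ?_ ?_
    · intro s _ h
      exact continuousOn_const.mul ((h i).log fun t _ => ((γ t).2.2 i).ne')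
    · intro t h1 h2
      refine ⟨_, ((h2 i).hasDerivAt.log ((γ t).2.2 i).ne').const_mul e, ?_⟩
      refine (le_abs_self _).trans ?_
      rw [abs_mul, he, one_mul]
      refine Real.abs_le_sqrt ?_
      have h3 : 0 ≤ k * gSO (γ t).1 (velSO (fun s => (γ s).1) t) (velSO (fun s => (γ s).1) t) := by
        rw [gSO_velSO (c := fun s => (γ s).1) h1]
        exact mul_nonneg hk (mul_nonneg (by norm_num) (frobSq_nonneg _))
      have h4 := Finset.single_le_sum (f := fun i => ((γ t).2.1 i)⁻¹ *
        deriv (fun s => (γ s).2.1 i) t * (((γ t).2.1 i)⁻¹ * deriv (fun s => (γ s).2.1 i) t))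
        (fun j _ => mul_self_nonneg _) (Finset.mem_univ i)
      simp only [gDiag]
      calc _ = ((γ t).2.1 i)⁻¹ *
            deriv (fun s => (γ s).2.1 i) t * (((γ t).2.1 i)⁻¹ * deriv (fun s => (γ s).2.1 i) t) := by
              ring
        _ ≤ _ := by linarith
  rw [abs_le]
  constructor
  · linarith [key (-1) (by simp)]
  · linarith [key 1 (by simp)]

/-- Spherical estimate behind the angle bound: if `z, w` are unit vectors, `w'` is orthogonal to `w`,
then `⟨z, w'⟩² ≤ (1 - ⟨z, w⟩²) |w'|²`. -/
theorem trace_sq_le_of_unit {m n : Type*} [Fintype m] [Fintype n] {z w w' : Matrix m n ℝ}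
    (hz : frobSq z = 1) (hw : frobSq w = 1) (ho : (wᵀ * w').trace = 0) :
    (zᵀ * w').trace ^ 2 ≤ (1 - (zᵀ * w).trace ^ 2) * frobSq w' := by
  set h := (zᵀ * w).trace with hh
  have h2 : (wᵀ * z).trace = h := by
    rw [hh, ← Matrix.trace_transpose (zᵀ * w)]; simp
  have e1 : ((z - h • w)ᵀ * w').trace = (zᵀ * w').trace := by
    simp [Matrix.sub_mul, ho]
  have e2 : frobSq (z - h • w) = 1 - h ^ 2 := by
    rw [frobSq] at hz hw ⊢
    simp only [Matrix.transpose_sub, Matrix.transpose_smul, Matrix.sub_mul, Matrix.mul_sub,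
      Matrix.smul_mul, Matrix.mul_smul, Matrix.trace_sub, Matrix.trace_smul, hz, hw, h2, ← hh,
      smul_eq_mul]
    ring
  rw [← e1, ← e2]
  exact trace_transpose_mul_sq_le _ _

/-- The curve `U(t) Z` stays on the unit Frobenius sphere, where the angle from its starting point
grows no faster than `|U' Z|`. The hypothesis on skew matrices, applied to `Uᵀ U'`, bounds `κ |U'
Z|` by the speed in `SO(p)`. -/
theorem angle_le_length {p : ℕ} {n : Type*} [Fintype n] {k κ : ℝ} (hk : 0 ≤ k)
    {γ : ℝ → M p} (hγ : IsPiecewiseSmoothM 0 1 γ) {Z : Matrix (Fin p) n ℝ} (hZ : frobSq Z = 1)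
    (hA : ∀ A : Matrix (Fin p) (Fin p) ℝ, Aᵀ = -A →
      κ ^ 2 * frobSq (A * Z) ≤ 1 / 2 * frobSq A) :
    Real.sqrt k * κ * Real.arccos ((((γ 0).1.1 * Z)ᵀ * ((γ 1).1.1 * Z)).trace) ≤
      length k γ 0 1 := by
  set z := (γ 0).1.1 * Z with hz
  have hU : ∀ t, frobSq ((γ t).1.1 * Z) = 1 := fun t => by
    rw [frobSq_orthogonal_mul (SO_transpose_mul _), hZ]
  set h : ℝ → ℝ := fun t => (zᵀ * ((γ t).1.1 * Z)).trace with hh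
  have hle : ∀ t, h t ^ 2 ≤ 1 := fun t => by
    have := trace_transpose_mul_sq_le z ((γ t).1.1 * Z)
    rwa [hz, hU, hU, one_mul, ← hz] at this
  have hsum : ∀ t, h t = ∑ j, ∑ i, z i j * ∑ l, (γ t).1.1 i l * Z l j := fun t => by
    simp only [hh, trace_transpose_mul_eq_sum, Matrix.mul_apply]
  -- `arccos` is not differentiable at `±1`, values that `h` can take. Shrinking the argument by `r
  -- < 1` avoids them and keeps the estimate; `r → 1` recovers the claim.
  have key : ∀ r : ℝ, 0 < r → r < 1 →
      Real.sqrt k * κ * Real.arccos (r * h 1) - Real.sqrt k * κ * Real.arccos (r * h 0) ≤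
        length k γ 0 1 := by
    intro r hr0 hr1
    refine sub_le_length hγ (Ψ := fun t => Real.sqrt k * κ * Real.arccos (r * h t)) ?_ ?_
    · intro s hs _
      refine continuousOn_const.mul (Real.continuous_arccos.comp_continuousOn
        (continuousOn_const.mul ?_))
      simp only [funext hsum]
      exact continuousOn_finsetSum _ fun j _ => continuousOn_finsetSum _ fun i _ =>
        continuousOn_const.mul (continuousOn_finsetSum _ fun l _ => (hs i l).mul continuousOn_const)
    · intro t h1 h2
      set c : ℝ → SO p := fun s => (γ s).1 with hc
      set T := velSO c t with hT
      have hd : HasDerivAt h ((zᵀ * (T * Z)).trace) t := by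
        simp only [funext hsum, trace_transpose_mul_eq_sum, Matrix.mul_apply]
        exact HasDerivAt.fun_sum fun j _ => HasDerivAt.fun_sum fun i _ =>
          (HasDerivAt.fun_sum fun l _ =>
            (hasDerivAt_velSO (c := c) h1 i l).mul_const (Z l j)).const_mul (z i j)
      have hskew : ((c t).1ᵀ * T)ᵀ = -((c t).1ᵀ * T) := velSO_skew (c := c) h1
      have hct : ((c t).1ᵀ)ᵀ * (c t).1ᵀ = 1 := by simpa using SO_mul_transpose (c t)
      have ho : (((c t).1 * Z)ᵀ * (T * Z)).trace = 0 := by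
        have e1 : ((c t).1 * Z)ᵀ * (T * Z) = Zᵀ * (((c t).1ᵀ * T) * Z) := by
          simp only [Matrix.transpose_mul, Matrix.mul_assoc]
        have e2 : (Zᵀ * (((c t).1ᵀ * T) * Z)).trace = -(Zᵀ * (((c t).1ᵀ * T) * Z)).trace := by
          conv_lhs => rw [← Matrix.trace_transpose, Matrix.transpose_mul, Matrix.transpose_mul,
            hskew]
          simp [Matrix.mul_assoc]
        rw [e1]; linarith
      have hb := trace_sq_le_of_unit (hU 0) (hU t) ho
      rw [← hz] at hb
      have hTZ : κ ^ 2 * frobSq (T * Z) ≤ 1 / 2 * frobSq T := by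
        have h3 := hA _ hskew
        rwa [Matrix.mul_assoc, frobSq_orthogonal_mul hct, frobSq_orthogonal_mul hct] at h3
      have hlt : (r * h t) ^ 2 < 1 := by
        rw [mul_pow]
        nlinarith [hle t, sq_nonneg (h t)]
      have hne := (sq_lt_one_iff_abs_lt_one _).1 hlt
      rw [abs_lt] at hne
      refine ⟨_, ((Real.hasDerivAt_arccos hne.1.ne' hne.2.ne).comp t
        (hd.const_mul r)).const_mul (Real.sqrt k * κ), ?_⟩
      refine Real.le_sqrt_of_sq_le ?_
      have hg : gSO (γ t).1 T T = 1 / 2 * frobSq T := gSO_velSO (c := c) h1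
      have hp : 0 < 1 - (r * h t) ^ 2 := by linarith
      set H := (zᵀ * (T * Z)).trace with hH
      have hsq : (Real.sqrt k * κ * (-(1 / Real.sqrt (1 - (r * h t) ^ 2)) * (r * H))) ^ 2 =
          k * (κ ^ 2 * (r ^ 2 * H ^ 2 / (1 - (r * h t) ^ 2))) := by
        have a1 := Real.sq_sqrt hk
        have a2 := Real.sq_sqrt hp.le
        rw [mul_pow, mul_pow, mul_pow, neg_sq, div_pow, a1, a2]
        ring
      rw [hsq]
      have hfr : r ^ 2 * H ^ 2 / (1 - (r * h t) ^ 2) ≤ frobSq (T * Z) := by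
        rw [div_le_iff₀ hp]
        have hF := frobSq_nonneg (T * Z)
        have hr2 : r ^ 2 ≤ 1 := by nlinarith
        calc r ^ 2 * H ^ 2 ≤ r ^ 2 * ((1 - h t ^ 2) * frobSq (T * Z)) := by gcongr
          _ = (r ^ 2 - (r * h t) ^ 2) * frobSq (T * Z) := by ring
          _ ≤ (1 - (r * h t) ^ 2) * frobSq (T * Z) := by gcongr
          _ = _ := mul_comm _ _
      have hD := gDiag_self_nonneg (γ t).2 (fun i => deriv (fun s => (γ s).2.1 i) t)
      calc k * (κ ^ 2 * (r ^ 2 * H ^ 2 / (1 - (r * h t) ^ 2)))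
          ≤ k * (κ ^ 2 * frobSq (T * Z)) := by gcongr
        _ ≤ k * gSO (γ t).1 T T := by rw [hg]; gcongr
        _ ≤ _ := by linarith
  have hlim : Filter.Tendsto (fun r : ℝ => Real.sqrt k * κ * Real.arccos (r * h 1) -
      Real.sqrt k * κ * Real.arccos (r * h 0)) (nhdsWithin 1 (Set.Iio 1))
      (nhds (Real.sqrt k * κ * Real.arccos (1 * h 1) -
        Real.sqrt k * κ * Real.arccos (1 * h 0))) := by
    refine (Continuous.tendsto ?_ 1).mono_left nhdsWithin_le_nhds
    have := Real.continuous_arccos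
    fun_prop
  have hfin := le_of_tendsto hlim (Filter.mem_of_superset (Ioo_mem_nhdsLT zero_lt_one)
    fun r hr => key r hr.1 hr.2)
  have h0 : h 0 = 1 := hU 0
  simpa [h0] using hfin

/-! ### Smooth connectedness of `SO(p)` and `M(p)` -/

/-- The reflection of `ℝᵖ` in the hyperplane orthogonal to `w`. -/
noncomputable def householder {p : ℕ} (w : Fin p → ℝ) : Matrix (Fin p) (Fin p) ℝ :=
  1 - (2 / (w ⬝ᵥ w)) • vecMulVec w w

theorem householder_mulVec {p : ℕ} (w x : Fin p → ℝ) :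
    householder w *ᵥ x = x - (2 * (w ⬝ᵥ x) / (w ⬝ᵥ w)) • w := by
  rw [householder, Matrix.sub_mulVec, Matrix.one_mulVec, Matrix.smul_mulVec,
    Matrix.vecMulVec_mulVec]
  ext i
  simp
  ring

theorem householder_mul_self {p : ℕ} {w : Fin p → ℝ} (hw : w ⬝ᵥ w ≠ 0) :
    householder w * householder w = 1 := by
  have h : vecMulVec w w * vecMulVec w w = (w ⬝ᵥ w) • vecMulVec w w := by
    rw [Matrix.vecMulVec_mul_vecMulVec]
    ext i j; simp [vecMulVec_apply]; ring
  simp only [householder, Matrix.sub_mul, Matrix.mul_sub, Matrix.one_mul, Matrix.mul_one,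
    Matrix.smul_mul, Matrix.mul_smul, h]
  ext i j
  simp only [Matrix.sub_apply, Matrix.smul_apply, smul_eq_mul]
  field_simp
  ring

theorem householder_transpose {p : ℕ} (w : Fin p → ℝ) : (householder w)ᵀ = householder w := by
  simp [householder, Matrix.transpose_vecMulVec]

theorem householder_orthogonal {p : ℕ} {w : Fin p → ℝ} (hw : w ⬝ᵥ w ≠ 0) :
    (householder w)ᵀ * householder w = 1 := by
  rw [householder_transpose, householder_mul_self hw]

theorem householder_neg {p : ℕ} (w : Fin p → ℝ) : householder (-w) = householder w := by
  simp [householder, Matrix.vecMulVec_neg, Matrix.neg_vecMulVec]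

/-- `B` is joined to `C` by a smooth curve of orthogonal matrices. -/
def SmoothlyJoined {p : ℕ} (B C : Matrix (Fin p) (Fin p) ℝ) : Prop :=
  ∃ c : ℝ → Matrix (Fin p) (Fin p) ℝ, (∀ i j, ContDiff ℝ ∞ fun t => c t i j) ∧
    (∀ t, (c t)ᵀ * c t = 1) ∧ c 0 = B ∧ c 1 = C

theorem SmoothlyJoined.refl {p : ℕ} {B : Matrix (Fin p) (Fin p) ℝ} (hB : Bᵀ * B = 1) :
    SmoothlyJoined B B :=
  ⟨fun _ => B, fun _ _ => contDiff_const, fun _ => hB, rfl, rfl⟩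

theorem SmoothlyJoined.mul {p : ℕ} {B C B' C' : Matrix (Fin p) (Fin p) ℝ}
    (h : SmoothlyJoined B C) (h' : SmoothlyJoined B' C') : SmoothlyJoined (B * B') (C * C') := by
  obtain ⟨c, c1, c2, rfl, rfl⟩ := h
  obtain ⟨d, d1, d2, rfl, rfl⟩ := h'
  refine ⟨fun t => c t * d t, fun i j => ?_, fun t => ?_, rfl, rfl⟩
  · simp only [Matrix.mul_apply]
    exact ContDiff.sum fun l _ => (c1 i l).mul (d1 l j)
  · rw [Matrix.transpose_mul, Matrix.mul_assoc, ← Matrix.mul_assoc (c t)ᵀ, c2, Matrix.one_mul, d2]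

/-- A reflection does not change when its normal vector changes sign, so the two normals may be
taken at an angle of at most `π/2`. The line through them then avoids the origin, and the
reflections in its points form the curve. -/
theorem smoothlyJoined_householder {p : ℕ} {v e : Fin p → ℝ} (hv : v ⬝ᵥ v = 1) (he : e ⬝ᵥ e = 1) :
    SmoothlyJoined (householder v) (householder e) := by
  wlog hve : 0 ≤ v ⬝ᵥ e generalizing v
  · rw [← householder_neg v]
    exact this (by simpa using hv) (by rw [neg_dotProduct]; linarith)
  have hve' : e ⬝ᵥ v = v ⬝ᵥ e := dotProduct_comm _ _
  have hpos : ∀ t : ℝ, ((1 - t) • v + t • e) ⬝ᵥ ((1 - t) • v + t • e) ≠ 0 := by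
    intro t
    simp only [dotProduct_add, add_dotProduct, smul_dotProduct, dotProduct_smul, hv, he, hve',
      smul_eq_mul]
    have h1 : v ⬝ᵥ e ≤ 1 := by
      have : 0 ≤ (v - e) ⬝ᵥ (v - e) := by
        simp only [dotProduct]; exact Finset.sum_nonneg fun _ _ => mul_self_nonneg _
      simp only [dotProduct_sub, sub_dotProduct, hv, he, hve'] at this
      linarith
    -- With `c = v ⬝ᵥ e`, the squared norm is `(1 + c)/2 + (1 - c)/2 * (1 - 2t)²`, which is at least
    -- `1/2`.
    nlinarith [sq_nonneg (1 - 2 * t), mul_nonneg hve (sq_nonneg (1 - 2 * t))]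
  refine ⟨fun t => householder ((1 - t) • v + t • e), fun i j => ?_,
    fun t => householder_orthogonal (hpos t), by simp, by simp⟩
  have hcoord : ∀ i, ContDiff ℝ ∞ fun t : ℝ => ((1 - t) • v + t • e) i := fun i => by
    simp only [Pi.add_apply, Pi.smul_apply, smul_eq_mul]; fun_prop
  simp only [householder, Matrix.sub_apply, Matrix.smul_apply, smul_eq_mul, vecMulVec_apply]
  refine contDiff_const.sub ((contDiff_const.div ?_ hpos).mul ((hcoord i).mul (hcoord j)))
  simp only [dotProduct]
  exact ContDiff.sum fun l _ => (hcoord l).mul (hcoord l)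

theorem dotProduct_mulVec_orthogonal {p : ℕ} {B : Matrix (Fin p) (Fin p) ℝ} (hB : Bᵀ * B = 1)
    (x y : Fin p → ℝ) : (B *ᵥ x) ⬝ᵥ (B *ᵥ y) = x ⬝ᵥ y := by
  rw [Matrix.dotProduct_mulVec, Matrix.vecMul_mulVec, hB, Matrix.vecMul_one]

/-- Cartan–Dieudonné by induction on the number `n` of basis vectors not known to be fixed. The
reflection with normal `B f - f` carries `B f` to `f` and preserves the vectors already fixed. Every
reflection used deforms to `householder e`, and two copies of that cancel, so only the parity of
their number remains. -/
theorem smoothlyJoined_one_or_householder {p : ℕ} {e : Fin p → ℝ} (he : e ⬝ᵥ e = 1) (n : ℕ) :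
    ∀ B : Matrix (Fin p) (Fin p) ℝ, Bᵀ * B = 1 →
      (∀ i : Fin p, (i : ℕ) + n < p → B *ᵥ Pi.single i 1 = Pi.single i 1) →
      SmoothlyJoined B 1 ∨ SmoothlyJoined B (householder e) := by
  have he0 : e ⬝ᵥ e ≠ 0 := by rw [he]; norm_num
  induction n with
  | zero =>
    intro B hB h
    have : B = 1 := by
      ext i j
      have := congrFun (h j (by omega)) i
      simpa [Matrix.one_apply, Pi.single_apply] using this
    subst this
    exact Or.inl (SmoothlyJoined.refl hB)
  | succ n ih =>
    intro B hB h
    rcases lt_or_ge n p with hn | hn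
    swap
    · exact ih B hB fun i hi => absurd hi (by omega)
    -- The first basis vector not known to be fixed.
    let m : Fin p := ⟨p - 1 - n, by omega⟩
    have hm : (m : ℕ) = p - 1 - n := rfl
    let f : Fin p → Fin p → ℝ := fun i => Pi.single i 1
    by_cases hbm : B *ᵥ f m = f m
    · refine ih B hB fun i hi => ?_
      by_cases him : i = m
      · rw [him]; exact hbm
      · exact h i (by have : (i : ℕ) ≠ m := fun h => him (Fin.ext h)
                      omega)
    set w := B *ᵥ f m - f m with hw
    have hff : f m ⬝ᵥ f m = 1 := by simp [f]
    have hbb : (B *ᵥ f m) ⬝ᵥ (B *ᵥ f m) = 1 := by rw [dotProduct_mulVec_orthogonal hB, hff]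
    have hcomm : f m ⬝ᵥ (B *ᵥ f m) = (B *ᵥ f m) ⬝ᵥ f m := dotProduct_comm _ _
    have hw0 : w ⬝ᵥ w ≠ 0 := fun h0 => by
      rw [dotProduct_self_eq_zero] at h0
      exact hbm (sub_eq_zero.1 h0)
    have hww : w ⬝ᵥ w = 2 * (w ⬝ᵥ (B *ᵥ f m)) := by
      rw [hw]
      simp only [sub_dotProduct, dotProduct_sub, hff, hbb, hcomm]
      ring
    have hB' : (householder w * B)ᵀ * (householder w * B) = 1 := by
      rw [Matrix.transpose_mul, Matrix.mul_assoc, ← Matrix.mul_assoc (householder w)ᵀ,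
        householder_orthogonal hw0, Matrix.one_mul, hB]
    have hih := ih (householder w * B) hB' fun i hi => by
      rw [← Matrix.mulVec_mulVec, householder_mulVec]
      by_cases him : i = m
      · rw [him, ← hww, div_self hw0, one_smul, hw]
        simp [f]
      · have hBi : B *ᵥ Pi.single i 1 = f i :=
          h i (by have : (i : ℕ) ≠ m := fun h => him (Fin.ext h)
                  omega)
        have hwi : w ⬝ᵥ f i = 0 := by
          rw [hw, sub_dotProduct]
          conv_lhs => enter [1]; rw [← hBi]
          rw [dotProduct_mulVec_orthogonal hB]
          simp [f]
        rw [hBi, hwi]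
        simp [f]
    have hBw : B = householder w * (householder w * B) := by
      rw [← Matrix.mul_assoc, householder_mul_self hw0, Matrix.one_mul]
    have hjoin : SmoothlyJoined (householder w) (householder e) := by
      have hpos : 0 < w ⬝ᵥ w := lt_of_le_of_ne
        (by simp only [dotProduct]; exact Finset.sum_nonneg fun _ _ => mul_self_nonneg _) hw0.symm
      have hs := Real.sq_sqrt hpos.le
      have hs0 : Real.sqrt (w ⬝ᵥ w) ≠ 0 := (Real.sqrt_pos.2 hpos).ne'
      have h1 : ((Real.sqrt (w ⬝ᵥ w))⁻¹ • w) ⬝ᵥ ((Real.sqrt (w ⬝ᵥ w))⁻¹ • w) = 1 := by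
        simp only [smul_dotProduct, dotProduct_smul, smul_eq_mul]
        field_simp
        exact hs.symm
      have h2 : householder ((Real.sqrt (w ⬝ᵥ w))⁻¹ • w) = householder w := by
        rw [householder, h1, householder, Matrix.smul_vecMulVec, Matrix.vecMulVec_smul, smul_smul,
          smul_smul]
        congr 2
        field_simp
        rw [hs]
      rw [← h2]
      exact smoothlyJoined_householder h1 he
    rw [hBw]
    rcases hih with h1 | h1
    · exact Or.inr (by simpa using hjoin.mul h1)
    · refine Or.inl ?_
      have := hjoin.mul h1
      rwa [householder_mul_self he0] at this

theorem det_householder_single {p : ℕ} (i : Fin p) :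
    (householder (Pi.single i 1 : Fin p → ℝ)).det = -1 := by
  have : householder (Pi.single i 1 : Fin p → ℝ) = diagonal fun j => if j = i then -1 else 1 := by
    ext a b
    by_cases hab : a = b
    · subst hab
      by_cases hai : a = i <;> simp [householder, vecMulVec_apply, hai]
      norm_num
    · by_cases hai : a = i <;> by_cases hbi : b = i <;>
        simp_all [householder, vecMulVec_apply]
  rw [this, det_diagonal, Finset.prod_ite_eq' Finset.univ i]
  simp

/-- `SO(p)` is connected by smooth curves. -/
theorem exists_smooth_curve_SO {p : ℕ} (hp : 0 < p) (U V : SO p) :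
    ∃ c : ℝ → SO p, (∀ i j, ContDiff ℝ ∞ fun t => (c t).1 i j) ∧ c 0 = U ∧ c 1 = V := by
  let e : Fin p → ℝ := Pi.single ⟨0, hp⟩ 1
  have he : e ⬝ᵥ e = 1 := by simp [e]
  have hdet : ∀ W : SO p, W.1.det = 1 := fun W => (mem_specialOrthogonalGroup_iff.1 W.2).2
  have hB : ((V.1)ᵀ * U.1)ᵀ * ((V.1)ᵀ * U.1) = 1 := by
    rw [transpose_mul, transpose_transpose, Matrix.mul_assoc, ← Matrix.mul_assoc V.1,
      SO_mul_transpose, Matrix.one_mul, SO_transpose_mul]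
  have hBd : ((V.1)ᵀ * U.1).det = 1 := by rw [det_mul, det_transpose, hdet, hdet, one_mul]
  have main : ∀ C, SmoothlyJoined ((V.1)ᵀ * U.1) C → ∃ c : ℝ → SO p,
      (∀ i j, ContDiff ℝ ∞ fun t => (c t).1 i j) ∧ c 0 = U ∧ (c 1).1 = V.1 * C := by
    rintro C ⟨b, b1, b2, b3, b4⟩
    have hb : ∀ t, (b t).det = 1 := by
      -- The determinant is continuous with square `1`, hence constant along the curve.
      have hcont : Continuous fun t => (b t).det :=
        Continuous.matrix_det (continuous_matrix fun i j => (b1 i j).continuous)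
      have := IsPreconnected.eq_of_sq_eq (f := fun t => (b t).det) (g := fun _ => (1 : ℝ))
        isPreconnected_univ hcont.continuousOn continuousOn_const
        (fun t _ => by
          have := congrArg Matrix.det (b2 t)
          rw [det_mul, det_transpose, det_one] at this
          simpa [sq] using this) (fun _ => one_ne_zero) (Set.mem_univ 0) (by rw [b3, hBd])
      exact fun t => this (Set.mem_univ t)
    have hm : ∀ t, V.1 * b t ∈ specialOrthogonalGroup (Fin p) ℝ := fun t =>
      mul_mem V.2 (mem_specialOrthogonalGroup_iff.2
        ⟨mem_unitaryGroup_iff'.2 (by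
          rw [star_eq_conjTranspose, conjTranspose_eq_transpose_of_trivial]; exact b2 t), hb t⟩)
    refine ⟨fun t => ⟨V.1 * b t, hm t⟩, fun i j => ?_, Subtype.ext ?_, congrArg (V.1 * ·) b4⟩
    · simp only [Matrix.mul_apply]
      exact ContDiff.sum fun l _ => contDiff_const.mul (b1 l j)
    · simp only [b3]
      rw [← Matrix.mul_assoc, SO_mul_transpose, Matrix.one_mul]
  rcases smoothlyJoined_one_or_householder he p _ hB (fun i hi => absurd hi (by omega)) with h | h
  · obtain ⟨c, c1, c2, c3⟩ := main _ h
    exact ⟨c, c1, c2, Subtype.ext (by rw [c3, Matrix.mul_one])⟩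
  · obtain ⟨c, c1, c2, c3⟩ := main _ h
    -- The end of the curve has determinant `1`, which excludes the odd parity.
    have h4 := congrArg Matrix.det c3
    rw [det_mul, hdet, hdet, det_householder_single] at h4
    norm_num at h4

theorem isPiecewiseSmooth_of_contDiff {ι : Type} {f : ι → ℝ → ℝ} (hf : ∀ i, ContDiff ℝ ∞ (f i)) :
    IsPiecewiseSmooth 0 1 f :=
  ⟨1, fun m => m, Nat.mono_cast, by simp, by simp, fun _ _ i => (hf i).contDiffOn⟩

theorem exists_piecewiseSmoothM {p : ℕ} (hp : 0 < p) (P Q : M p) :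
    ∃ γ : ℝ → M p, IsPiecewiseSmoothM 0 1 γ ∧ γ 0 = P ∧ γ 1 = Q := by
  obtain ⟨c, c1, c2, c3⟩ := exists_smooth_curve_SO hp P.1 Q.1
  let d : ℝ → DiagPos p := fun t => ⟨fun i => P.2.1 i * Real.exp (t *
    (Real.log (Q.2.1 i) - Real.log (P.2.1 i))), fun i => mul_pos (P.2.2 i) (Real.exp_pos _)⟩
  refine ⟨fun t => (c t, d t), isPiecewiseSmooth_of_contDiff ?_, ?_, ?_⟩
  · rintro (⟨i, j⟩ | i)
    · exact c1 i j
    · simp only [Sum.elim_inr, d]; fun_prop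
  · exact Prod.ext c2 (Subtype.ext (funext fun i => by simp [d]))
  · refine Prod.ext c3 (Subtype.ext (funext fun i => ?_))
    have h1 := P.2.2 i
    have h2 := Q.2.2 i
    simp only [d, one_mul, Real.exp_sub, Real.exp_log h1, Real.exp_log h2]
    field_simp

/-! ### Rotations in a plane -/

/-- The orthogonal projection onto the plane with orthonormal basis `u, v`. -/
def planeProj {p : ℕ} (u v : Fin p → ℝ) : Matrix (Fin p) (Fin p) ℝ :=
  vecMulVec u u + vecMulVec v v

/-- The infinitesimal rotation of the plane with orthonormal basis `u, v`. -/
def planeGen {p : ℕ} (u v : Fin p → ℝ) : Matrix (Fin p) (Fin p) ℝ :=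
  vecMulVec v u - vecMulVec u v

/-- `u, v` is an orthonormal pair of vectors of `ℝᵖ`. -/
structure OrthoPair {p : ℕ} (u v : Fin p → ℝ) : Prop where
  uu : u ⬝ᵥ u = 1
  vv : v ⬝ᵥ v = 1
  uv : u ⬝ᵥ v = 0

namespace OrthoPair

variable {p : ℕ} {u v : Fin p → ℝ}

theorem vu (h : OrthoPair u v) : v ⬝ᵥ u = 0 := by rw [dotProduct_comm, h.uv]

theorem proj_mul_proj (h : OrthoPair u v) :
    planeProj u v * planeProj u v = planeProj u v := by
  simp [planeProj, Matrix.add_mul, Matrix.mul_add, vecMulVec_mul_vecMulVec, h.uu, h.vv, h.uv, h.vu]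

theorem proj_mul_gen (h : OrthoPair u v) : planeProj u v * planeGen u v = planeGen u v := by
  simp [planeProj, planeGen, Matrix.add_mul, Matrix.mul_sub, vecMulVec_mul_vecMulVec, h.uu, h.vv,
    h.uv, h.vu]

theorem gen_mul_proj (h : OrthoPair u v) : planeGen u v * planeProj u v = planeGen u v := by
  simp [planeProj, planeGen, Matrix.sub_mul, Matrix.mul_add, vecMulVec_mul_vecMulVec, h.uu, h.vv,
    h.uv, h.vu]
  abel

theorem gen_mul_gen (h : OrthoPair u v) : planeGen u v * planeGen u v = -planeProj u v := by
  simp [planeProj, planeGen, Matrix.sub_mul, Matrix.mul_sub, vecMulVec_mul_vecMulVec, h.uu, h.vv,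
    h.uv, h.vu]
  abel

end OrthoPair

/-- The rotation by the angle `t` in the plane with orthonormal basis `u, v`. -/
noncomputable def planeRot {p : ℕ} (u v : Fin p → ℝ) (t : ℝ) : Matrix (Fin p) (Fin p) ℝ :=
  1 + (Real.cos t - 1) • planeProj u v + Real.sin t • planeGen u v

theorem planeRot_zero {p : ℕ} (u v : Fin p → ℝ) : planeRot u v 0 = 1 := by simp [planeRot]

theorem planeRot_pi {p : ℕ} (u v : Fin p → ℝ) :
    planeRot u v Real.pi = 1 - (2 : ℝ) • planeProj u v := by
  simp only [planeRot, Real.cos_pi, Real.sin_pi, zero_smul, add_zero]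
  norm_num [sub_eq_add_neg]

theorem planeRot_transpose {p : ℕ} (u v : Fin p → ℝ) (t : ℝ) :
    (planeRot u v t)ᵀ = planeRot u v (-t) := by
  have h1 : (planeProj u v)ᵀ = planeProj u v := by simp [planeProj, transpose_vecMulVec]
  have h2 : (planeGen u v)ᵀ = -planeGen u v := by simp [planeGen, transpose_vecMulVec]
  simp [planeRot, h1, h2]

theorem planeRot_periodic {p : ℕ} (u v : Fin p → ℝ) (t : ℝ) :
    planeRot u v (t - 2 * Real.pi) = planeRot u v t := by
  simp [planeRot]

theorem planeRot_mul {p : ℕ} {u v : Fin p → ℝ} (h : OrthoPair u v) (s t : ℝ) :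
    planeRot u v s * planeRot u v t = planeRot u v (s + t) := by
  simp only [planeRot, Matrix.add_mul, Matrix.mul_add, Matrix.one_mul, Matrix.mul_one,
    Matrix.smul_mul, Matrix.mul_smul, h.proj_mul_proj, h.proj_mul_gen, h.gen_mul_proj,
    h.gen_mul_gen, Real.cos_add, Real.sin_add]
  module

/-- The rotations `planeRot u v t` as elements of `SO(p)`. -/
noncomputable def planeRotSO {p : ℕ} {u v : Fin p → ℝ} (h : OrthoPair u v) (t : ℝ) : SO p :=
  ⟨planeRot u v t, by
    have ho : ∀ s, (planeRot u v s)ᵀ * planeRot u v s = 1 := fun s => by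
      rw [planeRot_transpose, planeRot_mul h, neg_add_cancel, planeRot_zero]
    refine mem_specialOrthogonalGroup_iff.2 ⟨mem_unitaryGroup_iff'.2 ?_, ?_⟩
    · rw [star_eq_conjTranspose, conjTranspose_eq_transpose_of_trivial]; exact ho t
    -- The rotation by `t` is the square of the rotation by `t / 2`, whose determinant is `±1`.
    · have h2 := congrArg Matrix.det (ho (t / 2))
      rw [det_mul, det_transpose, det_one] at h2
      rw [← add_halves t, ← planeRot_mul h, det_mul, h2]⟩

theorem frobSq_planeGen {p : ℕ} {u v : Fin p → ℝ} (h : OrthoPair u v) :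
    frobSq (planeGen u v) = 2 := by
  have h2 : (planeGen u v)ᵀ = -planeGen u v := by simp [planeGen, transpose_vecMulVec]
  rw [frobSq, h2, Matrix.neg_mul, h.gen_mul_gen, neg_neg, planeProj, trace_add, trace_vecMulVec,
    trace_vecMulVec, h.uu, h.vv]
  norm_num

theorem hasDerivAt_planeRot {p : ℕ} {u v : Fin p → ℝ} (h : OrthoPair u v) (a b t : ℝ)
    (i j : Fin p) : HasDerivAt (fun s => planeRot u v (a + b * s) i j)
      ((b • (planeRot u v (a + b * t) * planeGen u v)) i j) t := by
  have h1 : HasDerivAt (fun s : ℝ => a + b * s) b t := by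
    simpa using ((hasDerivAt_id t).const_mul b).const_add a
  have h2 := (((h1.cos.sub_const 1).mul_const (planeProj u v i j)).const_add
    ((1 : Matrix (Fin p) (Fin p) ℝ) i j)).add (h1.sin.mul_const (planeGen u v i j))
  have h3 : planeRot u v (a + b * t) * planeGen u v =
      (-Real.sin (a + b * t)) • planeProj u v + Real.cos (a + b * t) • planeGen u v := by
    simp only [planeRot, Matrix.add_mul, Matrix.one_mul, Matrix.smul_mul, h.proj_mul_gen,
      h.gen_mul_gen]
    module
  rw [h3]
  refine (h2.congr_deriv ?_).congr_of_eventuallyEq (Filter.Eventually.of_forall fun s => ?_)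
  · simp only [Matrix.smul_apply, Matrix.add_apply, smul_eq_mul]; ring
  · simp only [planeRot, Matrix.smul_apply, Matrix.add_apply, smul_eq_mul]; rfl

theorem contDiff_planeRot {p : ℕ} (u v : Fin p → ℝ) (a b : ℝ) (i j : Fin p) :
    ContDiff ℝ ∞ fun s => planeRot u v (a + b * s) i j := by
  simp only [planeRot, Matrix.smul_apply, Matrix.add_apply, smul_eq_mul]
  fun_prop

/-- The curve that rotates with constant angular velocity `b` and keeps the diagonal part fixed. -/
noncomputable def rotCurve {p : ℕ} {u v : Fin p → ℝ} (h : OrthoPair u v) (D : DiagPos p)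
    (a b : ℝ) (t : ℝ) : M p := (planeRotSO h (a + b * t), D)

theorem speed_rotCurve {p : ℕ} {u v : Fin p → ℝ} (h : OrthoPair u v) (D : DiagPos p) {k : ℝ}
    (a b t : ℝ) : speed k (rotCurve h D a b) t = Real.sqrt k * |b| := by
  have hd := hasDerivAt_planeRot h a b t
  have hv : velSO (fun s => (rotCurve h D a b s).1) t =
      b • (planeRot u v (a + b * t) * planeGen u v) := by
    ext i j
    exact (hd i j).deriv
  have hg := gSO_velSO (c := fun s => (rotCurve h D a b s).1) (t := t)
    fun i j => (hd i j).differentiableAt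
  have hf : frobSq (b • (planeRot u v (a + b * t) * planeGen u v)) = b ^ 2 * 2 := by
    have := frobSq_orthogonal_mul (SO_transpose_mul (planeRotSO h (a + b * t))) (planeGen u v)
    rw [frobSq_planeGen h] at this
    rw [← this, frobSq, frobSq]
    simp [planeRotSO, sq, mul_assoc]
  rw [speed, hg, hv, hf]
  have h0 : ∀ i, deriv (fun s => (rotCurve h D a b s).2.1 i) t = 0 := fun i =>
    deriv_const t (D.1 i)
  simp only [h0, gDiag, mul_zero, Finset.sum_const_zero, add_zero]
  rw [show k * (1 / 2 * (b ^ 2 * 2)) = b ^ 2 * k by ring, Real.sqrt_mul (sq_nonneg b),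
    Real.sqrt_sq_eq_abs, mul_comm]

theorem length_rotCurve {p : ℕ} {u v : Fin p → ℝ} (h : OrthoPair u v) (D : DiagPos p) {k : ℝ}
    (a b t : ℝ) : length k (rotCurve h D a b) 0 t = t * (Real.sqrt k * |b|) := by
  simp only [length, speed_rotCurve, intervalIntegral.integral_const, sub_zero, smul_eq_mul]

theorem isPiecewiseSmoothM_rotCurve {p : ℕ} {u v : Fin p → ℝ} (h : OrthoPair u v) (D : DiagPos p)
    (a b : ℝ) : IsPiecewiseSmoothM 0 1 (rotCurve h D a b) := by
  refine isPiecewiseSmooth_of_contDiff ?_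
  rintro (⟨i, j⟩ | i)
  · exact contDiff_planeRot u v a b i j
  · exact contDiff_const (c := D.1 i)

/-! ### Distances in `SO(p)` and the cut locus -/

theorem length_nonneg {p : ℕ} (k : ℝ) (γ : ℝ → M p) : 0 ≤ length k γ 0 1 :=
  intervalIntegral.integral_nonneg zero_le_one fun _ _ => Real.sqrt_nonneg _

/-- This transfers the length estimates for `M(p)`, with `k = 1`, to `SO(p)`. -/
theorem lengthSO_eq {p : ℕ} (c : ℝ → SO p) (D : DiagPos p) (a b : ℝ) :
    lengthSO c a b = length 1 (fun t => (c t, D)) a b := by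
  simp [lengthSO, length, speed, gDiag]

theorem isPiecewiseSmoothM_const {p : ℕ} {c : ℝ → SO p} (hc : IsPiecewiseSmoothSO 0 1 c)
    (D : DiagPos p) : IsPiecewiseSmoothM 0 1 fun t => (c t, D) := by
  obtain ⟨n, τ, h1, h2, h3, h4⟩ := hc
  refine ⟨n, τ, h1, h2, h3, fun m hm i => ?_⟩
  rcases i with ij | i
  · exact h4 m hm ij
  · exact contDiffOn_const (c := D.1 i)

theorem lengthSO_bddBelow {p : ℕ} (U V : SO p) : BddBelow {r | ∃ c : ℝ → SO p,
    IsPiecewiseSmoothSO 0 1 c ∧ c 0 = U ∧ c 1 = V ∧ r = lengthSO c 0 1} := by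
  refine ⟨0, ?_⟩
  rintro _ ⟨c, -, -, -, rfl⟩
  rw [lengthSO_eq c ⟨1, fun _ => one_pos⟩]
  exact length_nonneg _ _

theorem distSO_planeRotSO_le {p : ℕ} {u v : Fin p → ℝ} (h : OrthoPair u v) (s t : ℝ) :
    distSO (planeRotSO h s) (planeRotSO h t) ≤ |t - s| := by
  refine csInf_le (lengthSO_bddBelow _ _)
    ⟨fun r => planeRotSO h (s + (t - s) * r), ?_, by simp, by simp, ?_⟩
  · exact isPiecewiseSmooth_of_contDiff fun ij => contDiff_planeRot u v s (t - s) ij.1 ij.2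
  · rw [lengthSO_eq _ ⟨1, fun _ => one_pos⟩]
    have := length_rotCurve h ⟨1, fun _ => one_pos⟩ (k := 1) s (t - s) 1
    simp only [Real.sqrt_one, one_mul] at this
    exact this.symm

/-- A skew-symmetric matrix is bounded on unit vectors by `|A|_F / √2`. -/
theorem two_mul_skew_mulVec_le {p : ℕ} {A : Matrix (Fin p) (Fin p) ℝ} (hA : Aᵀ = -A)
    {x : Fin p → ℝ} (hx : x ⬝ᵥ x = 1) : 2 * ((A *ᵥ x) ⬝ᵥ (A *ᵥ x)) ≤ frobSq A := by
  set y := A *ᵥ x with hy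
  have hxy : x ⬝ᵥ y = 0 := by
    have h1 : x ⬝ᵥ y = -(x ⬝ᵥ y) := by
      conv_lhs => rw [hy, dotProduct_mulVec, ← mulVec_transpose, hA, neg_mulVec, neg_dotProduct,
        dotProduct_comm]
    linarith
  have hyx : y ⬝ᵥ x = 0 := by rw [dotProduct_comm, hxy]
  -- Cauchy–Schwarz against this skew matrix gains the factor `2` over the bound valid for arbitrary
  -- matrices.
  set B := vecMulVec y x - vecMulVec x y with hB
  have h1 : frobSq B = 2 * (y ⬝ᵥ y) := by
    rw [frobSq, hB]
    simp [transpose_vecMulVec, Matrix.sub_mul, Matrix.mul_sub, vecMulVec_mul_vecMulVec,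
      trace_vecMulVec, hx, hxy, hyx]
    ring
  have h2 : (Aᵀ * B).trace = 2 * (y ⬝ᵥ y) := by
    have a1 : Aᵀ * vecMulVec y x = vecMulVec (-(A *ᵥ y)) x := by
      rw [mul_vecMulVec, hA, neg_mulVec]
    have a2 : Aᵀ * vecMulVec x y = vecMulVec (-y) y := by
      rw [mul_vecMulVec, hA, neg_mulVec]
    have a3 : (A *ᵥ y) ⬝ᵥ x = -(y ⬝ᵥ y) := by
      rw [dotProduct_comm, dotProduct_mulVec, ← mulVec_transpose, hA, neg_mulVec, neg_dotProduct]
    rw [hB, Matrix.mul_sub, trace_sub, a1, a2, trace_vecMulVec, trace_vecMulVec, neg_dotProduct,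
      neg_dotProduct, a3]
    ring
  have h3 := trace_transpose_mul_sq_le A B
  rw [h1, h2] at h3
  have h4 : 0 ≤ y ⬝ᵥ y := by
    simp only [dotProduct]; exact Finset.sum_nonneg fun _ _ => mul_self_nonneg _
  rcases h4.eq_or_lt with h5 | h5
  · rw [← h5, mul_zero]; exact frobSq_nonneg A
  · nlinarith

/-- The length of a curve is at least `√k` times the angle by which a vector turns. -/
theorem vector_angle_le_length {p : ℕ} {k : ℝ} (hk : 0 ≤ k) {γ : ℝ → M p}
    (hγ : IsPiecewiseSmoothM 0 1 γ) {x : Fin p → ℝ} (hx : x ⬝ᵥ x = 1) :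
    Real.sqrt k * Real.arccos (((γ 0).1.1 *ᵥ x) ⬝ᵥ ((γ 1).1.1 *ᵥ x)) ≤ length k γ 0 1 := by
  have hf : ∀ y : Fin p → ℝ, frobSq (replicateCol Unit y) = y ⬝ᵥ y := fun y => by
    simp [frobSq_eq_sum, dotProduct, sq]
  have h := angle_le_length (κ := 1) hk hγ (Z := replicateCol Unit x) (by rw [hf, hx])
    fun A hA => by
      have := two_mul_skew_mulVec_le hA hx
      rw [← replicateCol_mulVec, hf]
      linarith
  rw [← replicateCol_mulVec, ← replicateCol_mulVec, trace_transpose_mul_eq_sum] at h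
  simpa [dotProduct] using h

theorem planeRot_mulVec_left {p : ℕ} {u v : Fin p → ℝ} (h : OrthoPair u v) (t : ℝ) :
    planeRot u v t *ᵥ u = Real.cos t • u + Real.sin t • v := by
  have h1 : planeProj u v *ᵥ u = u := by
    simp [planeProj, add_mulVec, vecMulVec_mulVec, h.uu, h.vu]
  have h2 : planeGen u v *ᵥ u = v := by
    simp [planeGen, sub_mulVec, vecMulVec_mulVec, h.uu, h.vu]
  simp only [planeRot, add_mulVec, one_mulVec, smul_mulVec, h1, h2]
  module

/-- The lower bound comes from `u`, which any curve between the two rotations must turn through the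
angle `|t - s|`. -/
theorem distSO_planeRotSO {p : ℕ} {u v : Fin p → ℝ} (h : OrthoPair u v) {s t : ℝ}
    (hst : |t - s| ≤ Real.pi) : distSO (planeRotSO h s) (planeRotSO h t) = |t - s| := by
  refine le_antisymm (distSO_planeRotSO_le h s t) (le_csInf ?_ ?_)
  · exact ⟨_, fun r => planeRotSO h (s + (t - s) * r), isPiecewiseSmooth_of_contDiff
      fun ij => contDiff_planeRot u v s (t - s) ij.1 ij.2, by simp, by simp, rfl⟩
  · rintro _ ⟨c, c1, c2, c3, rfl⟩
    rw [lengthSO_eq c ⟨1, fun _ => one_pos⟩]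
    have h1 := vector_angle_le_length zero_le_one
      (isPiecewiseSmoothM_const c1 ⟨1, fun _ => one_pos⟩) h.uu
    simp only [c2, c3, planeRotSO, planeRot_mulVec_left h, Real.sqrt_one, one_mul] at h1
    have h2 : (Real.cos s • u + Real.sin s • v) ⬝ᵥ (Real.cos t • u + Real.sin t • v) =
        Real.cos |t - s| := by
      rw [Real.cos_abs, Real.cos_sub]
      simp only [add_dotProduct, dotProduct_add, smul_dotProduct, dotProduct_smul, h.uu, h.vv,
        h.uv, h.vu, smul_eq_mul]
      ring
    rwa [h2, Real.arccos_cos (abs_nonneg _) hst] at h1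

/-- Up to angle `π` the rotation is minimizing; past `π`, turning the other way round is shorter. -/
theorem planeRotSO_pi_mem_cutLocus {p : ℕ} {u v : Fin p → ℝ} (h : OrthoPair u v) :
    planeRotSO h Real.pi ∈ cutLocusSO (planeRotSO h 0) := by
  refine ⟨planeRotSO h, fun t₀ => ⟨1, one_pos, fun t₁ t₂ h1 h2 => ?_⟩, rfl, Real.pi, Real.pi_pos,
    rfl, ?_, fun t ht => ?_⟩
  · rw [abs_sub_comm t₁ t₂]
    refine distSO_planeRotSO h ?_
    rw [abs_lt] at h1 h2
    have := Real.pi_gt_three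
    exact abs_le.2 ⟨by linarith, by linarith⟩
  · rw [distSO_planeRotSO h (by simp [abs_of_pos Real.pi_pos])]
    simp [abs_of_pos Real.pi_pos]
  · have h1 : planeRotSO h t = planeRotSO h (t - 2 * Real.pi) :=
      Subtype.ext (planeRot_periodic u v t).symm
    rw [h1]
    refine (distSO_planeRotSO_le h _ _).trans_lt ?_
    have := Real.pi_pos
    exact abs_lt.2 ⟨by linarith, by linarith⟩

/-! ### Sign changes of the half turn -/

/-- Equivalent to `x ≤ cos (π/√2) = -sin δ` with `δ = π/√2 - π/2 < 0.6507`. The margin is small: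
`sin δ` is about `0.606` and `34/55` about `0.618`. -/
theorem pi_le_sqrt_two_mul_arccos {x : ℝ} (hx : x ≤ -(34 / 55)) :
    Real.pi ≤ Real.sqrt 2 * Real.arccos x := by
  have h2 : Real.sqrt 2 ^ 2 = 2 := Real.sq_sqrt (by norm_num)
  have h0 : 0 < Real.sqrt 2 := by positivity
  have hlt : Real.sqrt 2 < 1.41422 := by
    rw [Real.sqrt_lt' (by norm_num)]; norm_num
  have hgt : 1 < Real.sqrt 2 := by nlinarith
  have hpi := Real.pi_lt_d4
  have hpos := Real.pi_pos
  set δ := Real.pi * (Real.sqrt 2 - 1) / 2 with hδ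
  have hδ0 : 0 ≤ δ := by
    have : 0 ≤ Real.sqrt 2 - 1 := by linarith
    positivity
  have hδ1 : δ ≤ 0.6507 := by
    rw [hδ]; nlinarith
  have hsin : Real.sin δ ≤ 34 / 55 := by
    have h3 : Real.sin δ ≤ Real.sin 0.6507 :=
      Real.sin_le_sin_of_le_of_le_pi_div_two (by linarith) (by linarith [Real.pi_gt_three]) hδ1
    have h4 := (abs_le.1 (Real.sin_bound (x := 0.6507) (by rw [abs_of_pos] <;> norm_num))).2
    rw [abs_of_pos (by norm_num)] at h4
    norm_num at h4 h3 ⊢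
    linarith
  have hdiv : Real.pi / Real.sqrt 2 = δ + Real.pi / 2 := by
    rw [hδ, div_eq_iff h0.ne']
    linear_combination (-Real.pi / 2) * h2
  have hcos : x ≤ Real.cos (Real.pi / Real.sqrt 2) := by
    rw [hdiv, Real.cos_add_pi_div_two]; linarith
  have h5 := Real.arccos_le_arccos hcos
  rw [Real.arccos_cos (by positivity) (div_le_self hpos.le hgt.le), div_le_iff₀ h0] at h5
  linarith

theorem planeProj_mulVec {p : ℕ} (u v x : Fin p → ℝ) :
    planeProj u v *ᵥ x = (u ⬝ᵥ x) • u + (v ⬝ᵥ x) • v := by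
  simp [planeProj, add_mulVec, vecMulVec_mulVec]

/-- The plane is in a position far from every coordinate plane: the products of the reflections in
the two planes have large rotation angles. -/
theorem exists_spread_frame {p : ℕ} {u v : Fin p → ℝ} (h : OrthoPair u v)
    (hq : ∀ i, u i ^ 2 + v i ^ 2 ≤ 21 / 110) {a b : Fin p} (hab : a ≠ b) :
    ∃ Z : Matrix (Fin p) (Fin p) ℝ, frobSq Z = 1 ∧
      (∀ A : Matrix (Fin p) (Fin p) ℝ, 2 * frobSq (A * Z) ≤ 1 / 2 * frobSq A) ∧
      (Zᵀ * ((1 - (2 : ℝ) • planeProj u v) *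
        (1 - (2 : ℝ) • planeProj (Pi.single a 1) (Pi.single b 1)) * Z)).trace ≤ -(34 / 55) := by
  set ea : Fin p → ℝ := Pi.single a 1 with hea
  set eb : Fin p → ℝ := Pi.single b 1 with heb
  have hE : OrthoPair ea eb := ⟨by simp [ea], by simp [eb], by simp [ea, eb, hab]⟩
  let X : Matrix (Fin p) (Fin 4) ℝ := Matrix.of fun i j => ![ea, eb, u, v] j i
  have hXw : ∀ w i, (X *ᵥ w) i = ea i * w 0 + eb i * w 1 + u i * w 2 + v i * w 3 := fun w i => by
    simp [X, mulVec, dotProduct, Fin.sum_univ_four]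
  -- In a linear relation the part `y` in the plane of `u, v` is supported on `{a, b}`. Each
  -- coordinate carries at most `21/110` of `|y|²`, so two cannot carry all of it and `y = 0`.
  have hinj : ∀ w, X *ᵥ w = 0 → w = 0 := by
    intro w hw
    have hw' : ∀ i, ea i * w 0 + eb i * w 1 + u i * w 2 + v i * w 3 = 0 := fun i => by
      rw [← hXw, hw]; rfl
    set y : Fin p → ℝ := w 2 • u + w 3 • v with hy
    have hyy : y ⬝ᵥ y = w 2 ^ 2 + w 3 ^ 2 := by
      simp only [hy, add_dotProduct, dotProduct_add, smul_dotProduct, dotProduct_smul, h.uu, h.vv,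
        h.uv, h.vu, smul_eq_mul]
      ring
    have hsum : y ⬝ᵥ y = y a * y a + y b * y b := by
      refine Fintype.sum_eq_add a b hab fun i hi => ?_
      have h1 := hw' i
      simp only [ea, eb, Pi.single_eq_of_ne hi.1, Pi.single_eq_of_ne hi.2] at h1
      have : y i = 0 := by simp only [hy, Pi.add_apply, Pi.smul_apply, smul_eq_mul]; linarith
      rw [this, mul_zero]
    have hyi : ∀ i, y i * y i ≤ (w 2 ^ 2 + w 3 ^ 2) * (21 / 110) := fun i => by
      have h1 := mul_le_mul_of_nonneg_left (hq i) (add_nonneg (sq_nonneg (w 2)) (sq_nonneg (w 3)))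
      simp only [hy, Pi.add_apply, Pi.smul_apply, smul_eq_mul]
      nlinarith [sq_nonneg (w 2 * v i - w 3 * u i)]
    have h0 : w 2 ^ 2 + w 3 ^ 2 ≤ 0 := by
      have := hyi a
      have := hyi b
      linarith
    have h2 : w 2 = 0 := by nlinarith [sq_nonneg (w 2), sq_nonneg (w 3)]
    have h3 : w 3 = 0 := by nlinarith [sq_nonneg (w 2), sq_nonneg (w 3)]
    have ha := hw' a
    have hb := hw' b
    simp only [ea, eb, Pi.single_eq_same, Pi.single_eq_of_ne hab, Pi.single_eq_of_ne hab.symm, h2,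
      h3] at ha hb
    ext j
    fin_cases j
    · simpa using ha
    · simpa using hb
    · exact h2
    · exact h3
  set G := Xᵀ * X with hG
  have hGu : IsUnit G := by
    rw [← Matrix.mulVec_injective_iff_isUnit]
    refine (injective_iff_map_eq_zero (Matrix.mulVecLin G)).2 fun w hw => hinj w ?_
    have h1 : w ⬝ᵥ (G *ᵥ w) = 0 := by
      rw [show G *ᵥ w = 0 from hw, dotProduct_zero]
    rw [hG, ← mulVec_mulVec, dotProduct_mulVec, vecMul_transpose] at h1
    exact dotProduct_self_eq_zero.1 h1
  have hGd : IsUnit G.det := (Matrix.isUnit_iff_isUnit_det G).1 hGu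
  have hGt : Gᵀ = G := by simp [hG]
  -- The orthogonal projection onto the span of the four columns, written with their Gram matrix.
  set N := X * G⁻¹ * Xᵀ with hN
  have hNt : Nᵀ = N := by
    simp [hN, transpose_nonsing_inv, hGt, Matrix.mul_assoc]
  have hNX : N * X = X := by
    rw [hN, Matrix.mul_assoc, ← hG, Matrix.mul_assoc, nonsing_inv_mul _ hGd, Matrix.mul_one]
  have hNN : N * N = N := by
    nth_rw 2 [hN]
    rw [← Matrix.mul_assoc, ← Matrix.mul_assoc, hNX]
  have hNtr : N.trace = 4 := by
    rw [hN, Matrix.mul_assoc, trace_mul_comm, Matrix.mul_assoc, ← hG, nonsing_inv_mul _ hGd]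
    simp
  have hcol : ∀ j, N *ᵥ (![ea, eb, u, v] j) = ![ea, eb, u, v] j := fun j => by
    ext i
    exact congrFun (congrFun hNX i) j
  have hproj : ∀ x y, N *ᵥ x = x → N *ᵥ y = y → planeProj x y * N = planeProj x y := by
    intro x y hx hy
    rw [planeProj, Matrix.add_mul, vecMulVec_mul, vecMulVec_mul, ← mulVec_transpose,
      ← mulVec_transpose, hNt, hx, hy]
  have hP : planeProj u v * N = planeProj u v := hproj u v (hcol 2) (hcol 3)
  have hEN : planeProj ea eb * N = planeProj ea eb := hproj ea eb (hcol 0) (hcol 1)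
  have hfs : ∀ A : Matrix (Fin p) (Fin p) ℝ, frobSq (A * ((1 / 2 : ℝ) • N)) =
      1 / 4 * frobSq (A * N) := fun A => by
    rw [frobSq, frobSq]
    simp only [Matrix.mul_smul, transpose_smul, Matrix.smul_mul, trace_smul, smul_eq_mul]
    ring
  -- The rank is four, so `N` has Frobenius norm `2`. Multiplication by `N` does not increase the
  -- norm, whence the bound for `A * Z`.
  refine ⟨(1 / 2 : ℝ) • N, ?_, fun A => ?_, ?_⟩
  · have := hfs 1
    rw [Matrix.one_mul, Matrix.one_mul] at this
    rw [this, frobSq, hNt, hNN, hNtr]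
    norm_num
  · rw [hfs]
    have h1 := frobSq_nonneg (A - A * N)
    have h2 : frobSq (A - A * N) = frobSq A - frobSq (A * N) := by
      have e1 : (Aᵀ * (A * N)).trace = frobSq (A * N) := by
        rw [frobSq, transpose_mul, hNt, Matrix.mul_assoc, trace_mul_comm N, ← Matrix.mul_assoc Aᵀ,
          Matrix.mul_assoc (Aᵀ * A), hNN]
      have e2 : ((A * N)ᵀ * A).trace = frobSq (A * N) := by
        rw [← e1, ← trace_transpose]; simp
      have e3 : ((A * N)ᵀ * (A * N)).trace = frobSq (A * N) := rfl
      have e4 : (Aᵀ * A).trace = frobSq A := rfl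
      change ((A - A * N)ᵀ * (A - A * N)).trace = _
      rw [transpose_sub, Matrix.sub_mul, Matrix.mul_sub, Matrix.mul_sub, trace_sub, trace_sub,
        trace_sub, e1, e2, e3, e4]
      ring
    linarith
  · have hs : (((1 / 2 : ℝ) • N)ᵀ * ((1 - (2 : ℝ) • planeProj u v) *
        (1 - (2 : ℝ) • planeProj ea eb) * ((1 / 2 : ℝ) • N))).trace = 1 / 4 *
        ((1 - (2 : ℝ) • planeProj u v) * (1 - (2 : ℝ) • planeProj ea eb) * N).trace := by
      simp only [Matrix.mul_smul, transpose_smul, Matrix.smul_mul, trace_smul, smul_eq_mul, hNt]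
      rw [trace_mul_comm, Matrix.mul_assoc, hNN]
      ring
    have he : (1 - (2 : ℝ) • planeProj u v) * (1 - (2 : ℝ) • planeProj ea eb) * N =
        N - (2 : ℝ) • planeProj u v - (2 : ℝ) • planeProj ea eb +
          (4 : ℝ) • (planeProj u v * planeProj ea eb) := by
      have hEN' : (1 - (2 : ℝ) • planeProj ea eb) * N = N - (2 : ℝ) • planeProj ea eb := by
        rw [Matrix.sub_mul, Matrix.one_mul, Matrix.smul_mul, hEN]
      rw [Matrix.mul_assoc, hEN', Matrix.sub_mul, Matrix.one_mul, Matrix.mul_sub, Matrix.smul_mul,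
        Matrix.smul_mul, Matrix.mul_smul, hP]
      module
    have htr : ∀ x y : Fin p → ℝ, OrthoPair x y → (planeProj x y).trace = 2 := fun x y hxy => by
      rw [planeProj, trace_add, trace_vecMulVec, trace_vecMulVec, hxy.uu, hxy.vv]; norm_num
    have hpe : (planeProj u v * planeProj ea eb).trace =
        (u a ^ 2 + v a ^ 2) + (u b ^ 2 + v b ^ 2) := by
      simp only [planeProj, Matrix.add_mul, Matrix.mul_add, vecMulVec_mul_vecMulVec, trace_add,
        trace_vecMulVec, ea, eb, dotProduct_single, vecMulVec_smul, smul_eq_mul, trace_smul]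
      simp
      ring
    -- The trace is `(4 - 4 - 4 + 4 t) / 4 = -1 + t`, where `t` is the sum of two terms bounded by
    -- `21/110`; and `-1 + 21/55 = -34/55`.
    rw [hs, he, trace_add, trace_sub, trace_sub, trace_smul, trace_smul, trace_smul, htr u v h,
      htr ea eb hE, hNtr, hpe]
    have := hq a
    have := hq b
    simp only [smul_eq_mul]
    linarith

/-- A subspace of dimension at least three spanned by coordinate vectors contains a unit vector
orthogonal to two given vectors. -/
theorem exists_unit_orthogonal {p : ℕ} (u v s : Fin p → ℝ)
    (hs : 3 ≤ (Finset.univ.filter fun i => s i = -1).card) :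
    ∃ x : Fin p → ℝ, x ⬝ᵥ x = 1 ∧ u ⬝ᵥ x = 0 ∧ v ⬝ᵥ x = 0 ∧ ∀ i, s i ≠ -1 → x i = 0 := by
  let L : (Fin p → ℝ) →ₗ[ℝ] (ℝ × ℝ) × ({i // ¬ s i = -1} → ℝ) :=
    ((dotProductBilin ℝ ℝ u).prod (dotProductBilin ℝ ℝ v)).prod
      (LinearMap.funLeft ℝ ℝ Subtype.val)
  have hlt : Module.finrank ℝ ((ℝ × ℝ) × ({i // ¬ s i = -1} → ℝ)) <
      Module.finrank ℝ (Fin p → ℝ) := by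
    have h1 := Fintype.card_subtype_compl fun i => s i = -1
    have h2 : Fintype.card {i // s i = -1} = (Finset.univ.filter fun i => s i = -1).card :=
      Fintype.card_subtype _
    have h3 : Fintype.card {i // s i = -1} ≤ Fintype.card (Fin p) := Fintype.card_subtype_le _
    simp only [Module.finrank_prod, Module.finrank_self, Module.finrank_fintype_fun_eq_card]
    omega
  obtain ⟨y, hy, hy0⟩ := Submodule.exists_mem_ne_zero_of_ne_bot (LinearMap.ker_ne_bot_of_finrank_lt
    (f := L) hlt)
  have hLy : L y = 0 := hy
  have hu : u ⬝ᵥ y = 0 := congrArg (fun z => z.1.1) hLy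
  have hv : v ⬝ᵥ y = 0 := congrArg (fun z => z.1.2) hLy
  have hz : ∀ i, s i ≠ -1 → y i = 0 := fun i hi => congrFun (congrArg (fun z => z.2) hLy) ⟨i, hi⟩
  have hyy : 0 < y ⬝ᵥ y := lt_of_le_of_ne
    (by simp only [dotProduct]; exact Finset.sum_nonneg fun _ _ => mul_self_nonneg _)
    fun h => hy0 (dotProduct_self_eq_zero.1 h.symm)
  have hs := Real.sq_sqrt hyy.le
  have hs0 : Real.sqrt (y ⬝ᵥ y) ≠ 0 := (Real.sqrt_pos.2 hyy).ne'
  refine ⟨(Real.sqrt (y ⬝ᵥ y))⁻¹ • y, ?_, by simp [hu], by simp [hv], fun i hi => by simp [hz i hi]⟩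
  simp only [smul_dotProduct, dotProduct_smul, smul_eq_mul]
  field_simp
  exact hs.symm

/-- Changing the signs of an even number of columns of the reflection in a spread plane does not
bring it closer to the identity. -/
theorem sqrt_mul_pi_le_length_of_sign_change {p : ℕ} {u v : Fin p → ℝ} (h : OrthoPair u v)
    (hq : ∀ i, u i ^ 2 + v i ^ 2 ≤ 21 / 110) {k : ℝ} (hk : 0 ≤ k) {γ : ℝ → M p}
    (hγ : IsPiecewiseSmoothM 0 1 γ) {s : Fin p → ℝ} (hs : ∀ i, s i = 1 ∨ s i = -1)
    (hdet : ∏ i, s i = 1)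
    (hV : (γ 1).1.1 = (1 - (2 : ℝ) • planeProj u v) * diagonal s * (γ 0).1.1) :
    Real.sqrt k * Real.pi ≤ length k γ 0 1 := by
  set U := (γ 0).1.1 with hU
  have hUU : U * Uᵀ = 1 := SO_mul_transpose _
  have hUU' : (Uᵀ)ᵀ * Uᵀ = 1 := by simpa using hUU
  have antipodal : ∀ x : Fin p → ℝ, x ⬝ᵥ x = 1 →
      (1 - (2 : ℝ) • planeProj u v) *ᵥ (diagonal s *ᵥ x) = -x →
      Real.sqrt k * Real.pi ≤ length k γ 0 1 := by
    intro x hx hRx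
    -- The curve carries `Uᵀ x` from `x` to `R S x = -x`.
    have h1 := vector_angle_le_length hk hγ (x := Uᵀ *ᵥ x)
      (by rw [dotProduct_mulVec_orthogonal hUU', hx])
    rwa [← hU, hV, mulVec_mulVec, mulVec_mulVec, Matrix.mul_assoc _ U, hUU, one_mulVec,
      Matrix.mul_one, ← mulVec_mulVec, hRx, dotProduct_neg, hx, Real.arccos_neg_one] at h1
  set J := Finset.univ.filter fun i => s i = -1 with hJ
  have hmem : ∀ i, i ∈ J ↔ s i = -1 := by simp [hJ]
  have hnot : ∀ i, i ∉ J → s i = 1 := fun i hi => (hs i).resolve_right (by rwa [← hmem])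
  rcases Nat.lt_or_ge J.card 3 with hc | hc
  swap
  -- Here `S` reverses `x` and the half turn fixes it.
  · obtain ⟨x, hx, hux, hvx, hxs⟩ := exists_unit_orthogonal u v s hc
    refine antipodal x hx ?_
    have h1 : diagonal s *ᵥ x = -x := by
      ext i
      rw [mulVec_diagonal, Pi.neg_apply]
      by_cases hi : s i = -1
      · rw [hi]; ring
      · rw [hxs i hi]; ring
    rw [h1, mulVec_neg, sub_mulVec, one_mulVec, smul_mulVec, planeProj_mulVec, hux, hvx]
    simp
  obtain hc | hc | hc : J.card = 0 ∨ J.card = 1 ∨ J.card = 2 := by omega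
  · have hs1 : s = 1 := funext fun i => hnot i (by rw [Finset.card_eq_zero.1 hc]; simp)
    refine antipodal u h.uu ?_
    rw [hs1, show diagonal (1 : Fin p → ℝ) = 1 from diagonal_one, one_mulVec, sub_mulVec,
      one_mulVec, smul_mulVec, planeProj_mulVec, h.uu, h.vu]
    module
  · obtain ⟨a, ha⟩ := Finset.card_eq_one.1 hc
    -- A single sign change has determinant `-1`.
    have hsa : ∏ i, s i = s a := Finset.prod_eq_single a
      (fun i _ hi => hnot i (by rw [ha]; simpa using hi)) (by simp)
    rw [hdet, (hmem a).1 (by rw [ha]; simp)] at hsa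
    norm_num at hsa
  · obtain ⟨a, b, hab, hJab⟩ := Finset.card_eq_two.1 hc
    obtain ⟨Z, hZ1, hZ2, hZ3⟩ := exists_spread_frame h hq hab
    have hS : diagonal s =
        1 - (2 : ℝ) • planeProj (Pi.single a 1 : Fin p → ℝ) (Pi.single b 1) := by
      ext i j
      have hsi : s i = if i = a ∨ i = b then -1 else 1 := by
        split_ifs with hi
        · exact (hmem i).1 (by rw [hJab]; simpa using hi)
        · exact hnot i (by rw [hJab]; simpa using hi)
      by_cases hij : i = j
      · subst hij
        by_cases hia : i = a
        · subst hia
          simp [planeProj, vecMulVec_apply, hsi, hab]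
          norm_num
        · by_cases hib : i = b
          · subst hib
            simp [planeProj, vecMulVec_apply, hsi, hia]
            norm_num
          · simp [planeProj, vecMulVec_apply, hsi, hia, hib]
      · have e1 : ∀ c : Fin p, (Pi.single c 1 : Fin p → ℝ) i * (Pi.single c 1 : Fin p → ℝ) j = 0 :=
          fun c => by
            by_cases hic : i = c
            · subst hic; simp [Ne.symm hij]
            · simp [hic]
        simp [planeProj, vecMulVec_apply, hij, e1]
    have h2 : (Real.sqrt 2) ^ 2 = 2 := Real.sq_sqrt (by norm_num)
    -- Taking `Uᵀ Z` makes the moving frame start at `Z`. The matrix `A Uᵀ` need not be skew, which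
    -- is why the bound on `Z` is available for all matrices.
    have h1 := angle_le_length (κ := Real.sqrt 2) hk hγ (Z := Uᵀ * Z)
      (by rw [frobSq_orthogonal_mul hUU', hZ1]) fun A _ => by
        rw [h2, ← Matrix.mul_assoc]
        have h3 := hZ2 (A * Uᵀ)
        have h4 : frobSq (A * Uᵀ) = frobSq A := by
          rw [frobSq, transpose_mul, transpose_transpose, trace_mul_comm, Matrix.mul_assoc,
            ← Matrix.mul_assoc Uᵀ, SO_transpose_mul, Matrix.one_mul, trace_mul_comm, frobSq]
        rwa [h4] at h3
    rw [← hU, hV, Matrix.mul_assoc _ U, ← Matrix.mul_assoc U, hUU, Matrix.one_mul, hS] at h1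
    have h5 := pi_le_sqrt_two_mul_arccos hZ3
    refine le_trans ?_ h1
    rw [mul_assoc]
    gcongr

/-! ### Curves between the two fibers -/

theorem exists_eq_of_conj_diagonal {p : ℕ} {G : Matrix (Fin p) (Fin p) ℝ} (hG : Gᵀ * G = 1)
    {d D : Fin p → ℝ} (h : G * diagonal d * Gᵀ = diagonal D) (i : Fin p) : ∃ j, d i = D j := by
  by_contra! hne
  have h1 : G * diagonal d = diagonal D * G := by
    rw [← h, Matrix.mul_assoc _ Gᵀ, hG, Matrix.mul_one]
  have h2 : ∀ j, G j i = 0 := fun j => by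
    have h3 := congrFun (congrFun h1 j) i
    rw [mul_diagonal, diagonal_mul] at h3
    have h4 : G j i * (d i - D j) = 0 := by linear_combination h3
    exact (mul_eq_zero.1 h4).resolve_right (sub_ne_zero.2 (hne j))
  have h5 := congrFun (congrFun hG i) i
  simp [Matrix.mul_apply, h2] at h5

theorem eq_diagonal_of_commute {p : ℕ} {S : Matrix (Fin p) (Fin p) ℝ} {D : Fin p → ℝ}
    (hD : Function.Injective D) (h : S * diagonal D = diagonal D * S) :
    S = diagonal fun i => S i i := by
  ext i j
  by_cases hij : i = j
  · subst hij; simp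
  · have h3 := congrFun (congrFun h i) j
    rw [mul_diagonal, diagonal_mul] at h3
    have h4 : S i j * (D j - D i) = 0 := by linear_combination h3
    rw [diagonal_apply_ne _ hij]
    exact (mul_eq_zero.1 h4).resolve_right (sub_ne_zero.2 fun h => hij (hD h).symm)

/-- Both diagonal parts of the endpoints consist of entries of `D`. If they differ somewhere, the
log gap is the cost. If they agree, the relative rotation `S` commutes with `D`, whose entries are
distinct, so it is a diagonal matrix of signs. -/
theorem sqrt_mul_pi_le_length {p : ℕ} {u v : Fin p → ℝ} (h : OrthoPair u v)
    (hq : ∀ i, u i ^ 2 + v i ^ 2 ≤ 21 / 110) {k : ℝ} (hk : 0 ≤ k) {D : DiagPos p}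
    (hinj : Function.Injective D.1)
    (hD : ∀ i j, i ≠ j → Real.sqrt k * Real.pi ≤ |Real.log (D.1 i) - Real.log (D.1 j)|)
    {γ : ℝ → M p} (hγ : IsPiecewiseSmoothM 0 1 γ) (h0 : γ 0 ∈ fiber (F (planeRotSO h 0, D)))
    (h1 : γ 1 ∈ fiber (F (planeRotSO h Real.pi, D))) :
    Real.sqrt k * Real.pi ≤ length k γ 0 1 := by
  set R := (planeRotSO h Real.pi).1 with hR
  set G := (γ 0).1.1 with hG
  set V := (γ 1).1.1 with hV
  have hGG : Gᵀ * G = 1 := SO_transpose_mul _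
  have hVV : Vᵀ * V = 1 := SO_transpose_mul _
  have hRR : R * Rᵀ = 1 := SO_mul_transpose _
  have hRR' : Rᵀ * R = 1 := SO_transpose_mul _
  have e0 : G * diagonal (γ 0).2.1 * Gᵀ = diagonal D.1 := by
    have := congrArg Subtype.val h0
    simpa [F, planeRotSO, planeRot_zero] using this
  have e1 : V * diagonal (γ 1).2.1 * Vᵀ = R * diagonal D.1 * Rᵀ := congrArg Subtype.val h1
  set H := Rᵀ * V with hH
  have hHH : Hᵀ * H = 1 := by
    rw [hH, transpose_mul, transpose_transpose, Matrix.mul_assoc, ← Matrix.mul_assoc R, hRR,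
      Matrix.one_mul, hVV]
  have e2 : H * diagonal (γ 1).2.1 * Hᵀ = diagonal D.1 := by
    rw [hH, transpose_mul, transpose_transpose]
    calc Rᵀ * V * diagonal (γ 1).2.1 * (Vᵀ * R) = Rᵀ * (V * diagonal (γ 1).2.1 * Vᵀ) * R := by
          simp only [Matrix.mul_assoc]
      _ = (Rᵀ * R) * diagonal D.1 * (Rᵀ * R) := by rw [e1]; simp only [Matrix.mul_assoc]
      _ = _ := by rw [hRR', Matrix.one_mul, Matrix.mul_one]
  by_cases hd : (γ 0).2.1 = (γ 1).2.1
  · rw [← hd] at e2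
    set S := H * Gᵀ with hS
    have hcomm : S * diagonal D.1 = diagonal D.1 * S := by
      calc S * diagonal D.1 = H * (Gᵀ * G) * diagonal (γ 0).2.1 * Gᵀ := by
            rw [hS, ← e0]; simp only [Matrix.mul_assoc]
        _ = H * diagonal (γ 0).2.1 * (Hᵀ * H) * Gᵀ := by rw [hGG, hHH]; simp
        _ = _ := by rw [hS, ← e2]; simp only [Matrix.mul_assoc]
    have hdiag := eq_diagonal_of_commute hinj hcomm
    have hSS : S * Sᵀ = 1 := by
      rw [hS, transpose_mul, transpose_transpose, Matrix.mul_assoc, ← Matrix.mul_assoc Gᵀ, hGG,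
        Matrix.one_mul]
      exact mul_eq_one_comm.1 hHH
    have hdet : S.det = 1 := by
      have hdet' : ∀ W : SO p, W.1.det = 1 := fun W => (mem_specialOrthogonalGroup_iff.1 W.2).2
      rw [hS, hH, det_mul, det_mul, det_transpose, det_transpose, hR, hV, hG, hdet', hdet', hdet']
      norm_num
    refine sqrt_mul_pi_le_length_of_sign_change h hq hk hγ (s := fun i => S i i) (fun i => ?_) ?_ ?_
    · have h3 := congrFun (congrFun hSS i) i
      rw [hdiag, diagonal_transpose, diagonal_mul_diagonal, diagonal_apply_eq, one_apply_eq] at h3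
      exact mul_self_eq_one_iff.1 h3
    · rw [← det_diagonal, ← hdiag, hdet]
    · rw [← hdiag, ← planeRot_pi]
      change V = R * S * G
      rw [hS, hH, Matrix.mul_assoc, Matrix.mul_assoc _ Gᵀ, hGG, Matrix.mul_one, ← Matrix.mul_assoc,
        hRR, Matrix.one_mul]
  · obtain ⟨i, hi⟩ := Function.ne_iff.1 hd
    obtain ⟨a, ha⟩ := exists_eq_of_conj_diagonal hGG e0 i
    obtain ⟨b, hb⟩ := exists_eq_of_conj_diagonal hHH e2 i
    refine le_trans ?_ (abs_log_sub_log_le_length hk hγ i)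
    rw [ha, hb]
    refine hD b a ?_
    rintro rfl
    exact hi (ha.trans hb.symm)

theorem lengthM_bddBelow {p : ℕ} (k : ℝ) (P Q : M p) : BddBelow {r | ∃ γ : ℝ → M p,
    IsPiecewiseSmoothM 0 1 γ ∧ γ 0 = P ∧ γ 1 = Q ∧ r = length k γ 0 1} := by
  refine ⟨0, ?_⟩
  rintro _ ⟨γ, -, -, -, rfl⟩
  exact length_nonneg _ _

theorem distM_nonneg {p : ℕ} (k : ℝ) (P Q : M p) : 0 ≤ distM k P Q := by
  refine Real.sInf_nonneg ?_
  rintro _ ⟨γ, -, -, -, rfl⟩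
  exact length_nonneg _ _

/-- A curve between two fibers that is no longer than any other has length `d_SR`. -/
theorem dSR_eq_length {p : ℕ} (hp : 0 < p) {k : ℝ} {X Y : SymPos p} {γ : ℝ → M p}
    (hγ : IsPiecewiseSmoothM 0 1 γ) (h0 : γ 0 ∈ fiber X) (h1 : γ 1 ∈ fiber Y)
    (hmin : ∀ γ' : ℝ → M p, IsPiecewiseSmoothM 0 1 γ' → γ' 0 ∈ fiber X → γ' 1 ∈ fiber Y →
      length k γ 0 1 ≤ length k γ' 0 1) : dSR k X Y = length k γ 0 1 := by
  refine le_antisymm ?_ (le_csInf ⟨_, γ 0, h0, γ 1, h1, rfl⟩ ?_)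
  · have hb : BddBelow {r | ∃ P ∈ fiber X, ∃ Q ∈ fiber Y, r = distM k P Q} := by
      refine ⟨0, ?_⟩
      rintro _ ⟨P, -, Q, -, rfl⟩
      exact distM_nonneg k P Q
    exact (csInf_le hb ⟨γ 0, h0, γ 1, h1, rfl⟩).trans
      (csInf_le (lengthM_bddBelow k _ _) ⟨γ, hγ, rfl, rfl, rfl⟩)
  · rintro _ ⟨P, hP, Q, hQ, rfl⟩
    -- A curve must exist: the infimum of the empty set is `0`, which would destroy the lower bound.
    obtain ⟨δ, d1, d2, d3⟩ := exists_piecewiseSmoothM hp P Q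
    refine le_csInf ⟨_, δ, d1, d2, d3, rfl⟩ ?_
    rintro _ ⟨γ', g1, g2, g3, rfl⟩
    exact hmin γ' g1 (g2 ▸ hP) (g3 ▸ hQ)

theorem isFMinimalGeodesic_rotCurve {p : ℕ} (hp : 0 < p) {u v : Fin p → ℝ} (h : OrthoPair u v)
    (hq : ∀ i, u i ^ 2 + v i ^ 2 ≤ 21 / 110) {k : ℝ} (hk : 0 ≤ k) {D : DiagPos p}
    (hinj : Function.Injective D.1)
    (hD : ∀ i j, i ≠ j → Real.sqrt k * Real.pi ≤ |Real.log (D.1 i) - Real.log (D.1 j)|)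
    {b : ℝ} (hb : |b| = Real.pi) (hend : rotCurve h D 0 b 1 = (planeRotSO h Real.pi, D)) :
    IsFMinimalGeodesic k (F (planeRotSO h 0, D)) (F (planeRotSO h Real.pi, D))
      (rotCurve h D 0 b) := by
  have h0 : rotCurve h D 0 b 0 ∈ fiber (F (planeRotSO h 0, D)) := by
    simp [fiber, rotCurve]
  have h1 : rotCurve h D 0 b 1 ∈ fiber (F (planeRotSO h Real.pi, D)) := by rw [hend]; rfl
  have hl := length_rotCurve h D (k := k) 0 b
  refine ⟨isPiecewiseSmoothM_rotCurve h D 0 b, h0, h1, ?_, fun t _ => ?_⟩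
  · refine (dSR_eq_length hp (isPiecewiseSmoothM_rotCurve h D 0 b) h0 h1
      fun γ' g1 g2 g3 => ?_).symm
    rw [hl, hb, one_mul]
    exact sqrt_mul_pi_le_length h hq hk hinj hD g1 g2 g3
  · rw [hl, hl, one_mul]

theorem rotCurve_pi_one {p : ℕ} {u v : Fin p → ℝ} (h : OrthoPair u v) (D : DiagPos p) :
    rotCurve h D 0 Real.pi 1 = (planeRotSO h Real.pi, D) := by simp [rotCurve]

theorem rotCurve_neg_pi_one {p : ℕ} {u v : Fin p → ℝ} (h : OrthoPair u v) (D : DiagPos p) :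
    rotCurve h D 0 (-Real.pi) 1 = (planeRotSO h Real.pi, D) := by
  refine Prod.ext (Subtype.ext ?_) rfl
  simp only [rotCurve, planeRotSO]
  rw [← planeRot_periodic u v Real.pi]
  congr 1
  ring

/-- Rotating diagonal matrices in opposite directions gives different curves. -/
theorem not_isReparametrization_rotCurve {p : ℕ} {u v : Fin p → ℝ} (h : OrthoPair u v)
    {D : DiagPos p} (hinj : Function.Injective D.1) {i j : Fin p} (hij : i ≠ j)
    (huv : u i * u j + v i * v j ≠ 0) {b : ℝ} (hb : |b| = Real.pi) :
    ¬ IsReparametrization (proj (rotCurve h D 0 b)) (proj (rotCurve h D 0 (-b))) := by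
  rintro ⟨φ, -, -, -, hφ⟩
  -- The midpoint suffices. If the projections agreed at the times `1/2` and `s`, the rotation by `θ
  -- = b (s + 1/2)` would commute with `D` and be diagonal, although `|θ|` lies in `[π/2, 3π/2]`.
  let t : unitInterval := ⟨1 / 2, by norm_num, by norm_num⟩
  have h1 := congrArg Subtype.val (congrFun hφ t)
  simp only [Function.comp, proj, F, rotCurve, planeRotSO, planeRot_transpose, t] at h1
  have hφt : (φ t : ℝ) ∈ Set.Icc (0 : ℝ) 1 := (φ t).2
  set s : ℝ := (φ t : ℝ) with hs
  change planeRot u v (0 + b * (1 / 2)) * diagonal D.1 * planeRot u v (-(0 + b * (1 / 2))) =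
    planeRot u v (0 + -b * s) * diagonal D.1 * planeRot u v (-(0 + -b * s)) at h1
  set θ := b * s + b * (1 / 2) with hθ
  have hcomm : planeRot u v θ * diagonal D.1 = diagonal D.1 * planeRot u v θ := by
    have h2 := congrArg (fun A => planeRot u v (b * s) * A * planeRot u v (b * (1 / 2))) h1
    simp only [← Matrix.mul_assoc, planeRot_mul h] at h2
    simp only [Matrix.mul_assoc, planeRot_mul h] at h2
    have a1 : b * s + (0 + b * (1 / 2)) = θ := by rw [hθ]; ring
    have a2 : -(0 + b * (1 / 2)) + b * (1 / 2) = 0 := by ring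
    have a3 : b * s + (0 + -b * s) = 0 := by ring
    have a4 : -(0 + -b * s) + b * (1 / 2) = θ := by rw [hθ]; ring
    rwa [a1, a2, a3, a4, planeRot_zero, Matrix.one_mul, Matrix.mul_one] at h2
  have hdiag := eq_diagonal_of_commute hinj hcomm
  have e1 := congrFun (congrFun hdiag i) j
  have e2 := congrFun (congrFun hdiag j) i
  rw [diagonal_apply_ne _ hij] at e1
  rw [diagonal_apply_ne _ hij.symm] at e2
  simp only [planeRot, planeProj, planeGen, Matrix.add_apply, Matrix.sub_apply, Matrix.smul_apply,
    vecMulVec_apply, one_apply_ne hij, one_apply_ne hij.symm, smul_eq_mul] at e1 e2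
  -- Averaging the entries `(i, j)` and `(j, i)` cancels the skew generator.
  have e3 : (Real.cos θ - 1) * (u i * u j + v i * v j) = 0 := by linear_combination (e1 + e2) / 2
  have e4 : Real.cos θ = 1 := by linarith [(mul_eq_zero.1 e3).resolve_right huv]
  have e5 : Real.cos |θ| = 1 := by rw [Real.cos_abs, e4]
  have hπ := Real.pi_pos
  have e6 : |θ| = Real.pi * s + Real.pi * (1 / 2) := by
    rw [hθ, ← mul_add, abs_mul, hb, abs_of_pos (by linarith [hφt.1]), mul_add]
  have e7 : Real.pi * s ≤ Real.pi * 1 := mul_le_mul_of_nonneg_left hφt.2 hπ.le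
  have e8 : 0 ≤ Real.pi * s := mul_nonneg hπ.le hφt.1
  have e9 := (Real.cos_eq_one_iff_of_lt_of_lt (x := |θ|) (by linarith [abs_nonneg θ])
    (by linarith)).1 e5
  linarith

/-- `F P` has the characteristic polynomial of its diagonal part, and its eigenvalues, listed with
multiplicity, are the roots. -/
theorem F_mem_topStratumSym {p : ℕ} {P : M p} (hP : P ∈ topStratumM p) :
    F P ∈ topStratumSym p := by
  have hroots := (F P).2.isHermitian.roots_charpoly_eq_eigenvalues
  have hchar : (F P).1.charpoly = (diagonal P.2.1).charpoly := by
    change (P.1.1 * diagonal P.2.1 * (P.1.1)ᵀ).charpoly = _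
    rw [charpoly_mul_comm, ← Matrix.mul_assoc, SO_transpose_mul, Matrix.one_mul]
  have hnd : (F P).1.charpoly.roots.Nodup := by
    have hprod := Polynomial.roots_multiset_prod_X_sub_C (Finset.univ.val.map P.2.1)
    rw [Multiset.map_map] at hprod
    rw [hchar, charpoly_diagonal, Finset.prod_eq_multiset_prod]
    refine hprod.symm ▸ Finset.univ.nodup.map hP
  rw [hroots, Multiset.nodup_map_iff_inj_on Finset.univ.nodup] at hnd
  intro i j hij
  exact hnd i (Finset.mem_univ i) j (Finset.mem_univ j) (by simp [hij])

/-! ### The spread plane and the separated diagonal -/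

/-- The constant unit vector. -/
noncomputable def spreadLeft (p : ℕ) : Fin p → ℝ := fun _ => 1 / Real.sqrt p

/-- The integer vector `(1, 1, 1, 1, 1, -1, -1, -1, -1, -1, 0, 0, …)`. -/
def signVec (n : ℕ) : ℝ := if n < 5 then 1 else if n < 10 then -1 else 0

/-- A unit vector orthogonal to the constant vector. -/
noncomputable def spreadRight (p : ℕ) : Fin p → ℝ := fun i => signVec i / Real.sqrt 10

theorem sum_signVec_pow {p : ℕ} (hp : 11 ≤ p) {n : ℕ} (hn : n ≠ 0) :
    ∑ i : Fin p, signVec i ^ n = 5 + 5 * (-1) ^ n := by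
  obtain ⟨m, rfl⟩ := Nat.exists_eq_add_of_le hp
  rw [Fin.sum_univ_eq_sum_range (fun i => signVec i ^ n) (11 + m), Finset.sum_range_add]
  have : ∀ i, signVec (11 + i) = 0 := fun i => by
    simp only [signVec]; rw [if_neg (by omega), if_neg (by omega)]
  simp only [this, zero_pow hn, Finset.sum_const_zero, add_zero]
  simp [Finset.sum_range_succ, signVec, hn]
  ring

theorem orthoPair_spread {p : ℕ} (hp : 11 ≤ p) : OrthoPair (spreadLeft p) (spreadRight p) := by
  have hp0 : (0 : ℝ) < p := by exact_mod_cast (by omega : 0 < p)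
  have h1 := Real.mul_self_sqrt hp0.le
  have h2 := Real.mul_self_sqrt (show (0 : ℝ) ≤ 10 by norm_num)
  refine ⟨?_, ?_, ?_⟩
  · simp only [spreadLeft, dotProduct, div_mul_div_comm, h1]
    simp [hp0.ne']
  · simp only [spreadRight, dotProduct, div_mul_div_comm, h2, ← Finset.sum_div]
    have := sum_signVec_pow hp (n := 2) (by norm_num)
    simp only [sq] at this
    rw [this]; norm_num
  · simp only [spreadLeft, spreadRight, dotProduct, ← Finset.mul_sum, ← Finset.sum_div]
    have := sum_signVec_pow hp (n := 1) (by norm_num)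
    simp only [pow_one] at this
    rw [this]; norm_num

/-- The bound is `1/11 + 1/10 = 21/110`; this is where `p ≥ 11` gives the constant. -/
theorem spread_sq_add_sq_le {p : ℕ} (hp : 11 ≤ p) (i : Fin p) :
    spreadLeft p i ^ 2 + spreadRight p i ^ 2 ≤ 21 / 110 := by
  have hp0 : (11 : ℝ) ≤ p := by exact_mod_cast hp
  have h1 : signVec i ^ 2 ≤ 1 := by
    simp only [signVec]; split_ifs <;> norm_num
  have h2 : (1 : ℝ) / p ≤ 1 / 11 := by gcongr
  rw [spreadLeft, spreadRight, div_pow, div_pow, Real.sq_sqrt (by linarith),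
    Real.sq_sqrt (by norm_num), one_pow]
  linarith

/-- A diagonal matrix whose entries are far apart. -/
noncomputable def gapDiag (p : ℕ) (k : ℝ) : DiagPos p :=
  ⟨fun i => Real.exp (i * (Real.sqrt k * Real.pi)), fun _ => Real.exp_pos _⟩

theorem gapDiag_gap {p : ℕ} {k : ℝ} {i j : Fin p} (hij : i ≠ j) :
    Real.sqrt k * Real.pi ≤ |Real.log ((gapDiag p k).1 i) - Real.log ((gapDiag p k).1 j)| := by
  have hnn : 0 ≤ Real.sqrt k * Real.pi := by have := Real.pi_pos; positivity
  have h1 : (1 : ℝ) ≤ |(i : ℝ) - (j : ℝ)| := by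
    have h2 : ((i : ℕ) : ℤ) - ((j : ℕ) : ℤ) ≠ 0 := by
      have : (i : ℕ) ≠ j := fun h => hij (Fin.ext h)
      omega
    exact_mod_cast Int.one_le_abs h2
  simp only [gapDiag, Real.log_exp, ← sub_mul]
  rw [abs_mul, abs_of_nonneg hnn]
  nlinarith

theorem gapDiag_injective {p : ℕ} {k : ℝ} (hk : 0 < k) : Function.Injective (gapDiag p k).1 := by
  intro i j hij
  by_contra hne
  have h1 := gapDiag_gap (k := k) hne
  rw [hij, sub_self, abs_zero] at h1
  have := mul_pos (Real.sqrt_pos.2 hk) Real.pi_pos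
  linarith

end ScalingRotation

theorem mainTheorem2 (p : ℕ) (hp : 11 ≤ p) (k : ℝ) (hk : 0 < k) :
    (∃ P Q : ScalingRotation.M p,
      P ∈ ScalingRotation.topStratumM p ∧ Q ∈ ScalingRotation.topStratumM p ∧
      ScalingRotation.IsGeodesicallyAntipodal P Q ∧ ScalingRotation.IsMinimalPair k P Q) ∧
    (∃ X Y : ScalingRotation.SymPos p,
      X ∈ ScalingRotation.topStratumSym p ∧ Y ∈ ScalingRotation.topStratumSym p ∧
      ScalingRotation.TypeIINonuniqueness k X Y) := by
  have h := ScalingRotation.orthoPair_spread hp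
  let D := ScalingRotation.gapDiag p k
  have hinj : Function.Injective D.1 := ScalingRotation.gapDiag_injective hk
  have hmin := fun b => ScalingRotation.isFMinimalGeodesic_rotCurve (by omega : 0 < p) h
    (ScalingRotation.spread_sq_add_sq_le hp) hk.le hinj
    (fun i j => ScalingRotation.gapDiag_gap) (b := b)
  have hpi : |Real.pi| = Real.pi := abs_of_pos Real.pi_pos
  have hplus := hmin Real.pi hpi (ScalingRotation.rotCurve_pi_one h D)
  have hminus := hmin (-Real.pi) (by rw [abs_neg, hpi]) (ScalingRotation.rotCurve_neg_pi_one h D)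
  have hstart : ∀ b, ScalingRotation.rotCurve h D 0 b 0 = (ScalingRotation.planeRotSO h 0, D) :=
    fun b => by simp [ScalingRotation.rotCurve]
  -- Coordinates `0` and `1` both lie in the block where the sign vector is `+1`, so the two
  -- products are positive.
  have huv : ScalingRotation.spreadLeft p ⟨0, by omega⟩ * ScalingRotation.spreadLeft p ⟨1, by omega⟩ +
      ScalingRotation.spreadRight p ⟨0, by omega⟩ * ScalingRotation.spreadRight p ⟨1, by omega⟩ ≠
        0 := by
    simp only [ScalingRotation.spreadLeft, ScalingRotation.spreadRight, ScalingRotation.signVec]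
    norm_num
    positivity
  have hne : (⟨0, by omega⟩ : Fin p) ≠ ⟨1, by omega⟩ := by simp
  refine ⟨⟨(ScalingRotation.planeRotSO h 0, D), (ScalingRotation.planeRotSO h Real.pi, D), hinj,
    hinj, Or.inl (ScalingRotation.planeRotSO_pi_mem_cutLocus h), _, hplus, hstart _,
    ScalingRotation.rotCurve_pi_one h D⟩, _, _,
    ScalingRotation.F_mem_topStratumSym (P := (ScalingRotation.planeRotSO h 0, D)) hinj,
    ScalingRotation.F_mem_topStratumSym (P := (ScalingRotation.planeRotSO h Real.pi, D)) hinj,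
    _, ⟨_, hplus, rfl⟩, _, ⟨_, hminus, rfl⟩,
    ScalingRotation.not_isReparametrization_rotCurve h hinj hne huv hpi, ?_, _, _,
    ⟨_, hplus, hstart _, ScalingRotation.rotCurve_pi_one h D, rfl⟩,
    ⟨_, hminus, hstart _, ScalingRotation.rotCurve_neg_pi_one h D, rfl⟩⟩
  have := ScalingRotation.not_isReparametrization_rotCurve h hinj hne huv (b := -Real.pi)
    (by rw [abs_neg, hpi])
  rwa [neg_neg] at this
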